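/- **Setting.** Let $q(\lambda), n(\lambda)$ be polynomially bounded functions of the security parameter $\lambda\in\mathbb N$ with $n(\lambda)=\omega(\log^2\lambda)$, and let $\mathcal Z=\{\mathcal Z(1^\lambda)\}_\lambda$ be a family of probability distributions on pairs $(p,\theta)\in\{0,1\}^{q(\lambda)}\times\{0,1\}^{n(\lambda)}$. A *nonuniform QPT algorithm* is a family of quantum channels, one for each $\lambda$, implemented by polynomial-size quantum circuits (one- and two-qubit unitary gates, ancillas in the state $|0\rangle$, output on some of the qubits, the rest discarded) which get as advice a quantum state on polynomially many qubits; a *distinguisher* is such an algorithm whose output is one bit. A function $f$ is *negligible* if $f(\lambda)=\lambda^{-\omega(1)}$. **Assumption (strong indistinguishability with advantage $\eta$).** Let $\eta$ be a negligible function such that for every nonuniform QPT distinguisher $\mathcal A=\{\mathcal A_\lambda\}$ there is $\lambda_0$ such that for all $\lambda\ge\lambda_0$ $$\bigl|\Pr[\mathcal A_\lambda(p,\theta)=1]-\Pr[\mathcal A_\lambda(p,\theta^*)=1]\bigr|\le\eta(\lambda),$$ where $(p,\theta)\leftarrow\mathcal Z(1^\lambda)$ and $\theta^*\leftarrow\{0,1\}^{n(\lambda)}$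 is uniform and independent of $(p,\theta)$. **Game.** (1) $(p,\theta)\leftarrow\mathcal Z(1^\lambda)$ is sampled and $p$ is revealed. (2) A QPT algorithm that gets $p$ (but not $\theta$) as input prepares a state $\rho^{(p)}_{ABC}$ on registers $A$, $B$ of $n(\lambda)$ qubits each and an arbitrary register $C$. (3) $A$ is measured in the $\theta$-basis $\{|x\rangle_\theta=H^{\theta_1}|x_1\rangle\otimes\cdots\otimes H^{\theta_n}|x_n\rangle\}_{x\in\{0,1\}^n}$, where $H$ is the Hadamard unitary, with outcome $K_A$, and $\theta$ is revealed. (4) $B$ is measured in the $\theta$-basis with outcome $K_B$, and $C$ is measured with an arbitrary, possibly inefficient, POVM $\{Q_C^{(k|p,\theta)}\}_{k\in\{0,1\}^n}$ with outcome $K_C$. A *strategy* consists of the preparation algorithm, which may be any nonuniform QPT algorithm (this includes uniform ones), and the POVMs. Its winning probability is $$p_{\rm win}(\lambda)=\Pr[K_A=K_B=K_C]=\mathop{\mathsf E}_{(p,\theta)\leftarrow\mathcal Z(1^\lambda)}\sum_{k}\operatorname{Tr}\Bigl(\bigl(|k\rangle\langle k|_\theta\otimes|k\rangle\langle k|_\theta\otimes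 Q_C^{(k|p,\theta)}\bigr)\rho^{(p)}_{ABC}\Bigr),$$ where $|k\rangle\langle k|_\theta$ denotes the projector onto $|k\rangle_\theta$. **Corollary 3.3.** There is a function $\varepsilon:\mathbb N\to\mathbb R$ with $\varepsilon(m)=\tilde O\bigl(2^{-\frac12\sqrt m}\bigr)$ as $m\to\infty$, i.e. $\varepsilon(m)=O\bigl(2^{-\frac12\sqrt m}\,|\log 2^{-\frac12\sqrt m}|^k\bigr)$ for some $k\in\mathbb N$, such that the following holds for all $q,n,\mathcal Z,\eta$ as above. For every strategy there is $\lambda_0$ such that for all $\lambda\ge\lambda_0$ $$p_{\rm win}(\lambda)\le\varepsilon(n(\lambda))+\eta(\lambda).$$ In particular, $p_{\rm win}$ is negligible. -/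

import Mathlib

open Filter Asymptotics
open scoped ComplexOrder

namespace CompMOE

/-! ### Qubit registers

A register whose qubits are labelled by a finite type `W` has the computational basis
`W → Bool`; operators on it are complex matrices indexed by bit strings. -/

/-- Operators on the register with qubits labelled by `W`. -/
abbrev Op (W : Type) : Type := Matrix (W → Bool) (W → Bool) ℂ

/-- Density operators: positive semidefinite with trace one. -/
def IsDensity {W : Type} [Fintype W] [DecidableEq W] (ρ : Op W) : Prop :=
  ρ.PosSemidef ∧ ρ.trace = 1

/-- The tensor product `M ⊗ N`, an operator on the composite register. -/
def tensor {V W : Type} (M : Op V) (N : Op W) : Op (V ⊕ W) :=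
  Matrix.of fun x y =>
    M (fun i => x (Sum.inl i)) (fun i => y (Sum.inl i)) *
      N (fun i => x (Sum.inr i)) (fun i => y (Sum.inr i))

/-- The projector `|v⟩⟨v|` (for a unit vector `v`). -/
noncomputable def ketbra {W : Type} (v : (W → Bool) → ℂ) : Op W :=
  Matrix.vecMulVec v (star v)

/-- The computational basis vector `|x⟩`. -/
noncomputable def ket {W : Type} [Fintype W] [DecidableEq W] (x : W → Bool) : (W → Bool) → ℂ :=
  Pi.single x 1

/-- The one-qubit Hadamard unitary. -/
noncomputable def hadamardGate : Matrix Bool Bool ℂ :=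
  Matrix.of fun a b => (if a && b then -1 else 1) / (Real.sqrt 2 : ℂ)

/-- The `θ`-basis vector `|x⟩_θ = H^θ |x⟩ = ⨂ᵢ H^{θᵢ} |xᵢ⟩`. -/
noncomputable def basisKet {W : Type} [Fintype W] (θ x : W → Bool) : (W → Bool) → ℂ :=
  fun y => ∏ i, (if θ i then hadamardGate else 1) (y i) (x i)

/-- The reduced state on the qubits selected by `out : O ↪ W`; all other qubits are traced out. -/
noncomputable def reduce {O W : Type} [Fintype O] [Fintype W] [DecidableEq W]
    (out : O ↪ W) (ρ : Op W) : Op O :=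
  Matrix.of fun a b => ∑ x : W → Bool, ∑ y : W → Bool,
    if (∀ o, x (out o) = a o) ∧ (∀ o, y (out o) = b o) ∧
        (∀ w, (∀ o, out o ≠ w) → x w = y w)
    then ρ x y else 0

/-- The classical state of a random bit string. -/
noncomputable def classicalState {W : Type} [DecidableEq W] [Fintype W]
    (μ : PMF (W → Bool)) : Op W :=
  Matrix.diagonal fun x => ((μ x).toReal : ℂ)

/-- A POVM on the register `W` with outcomes in `K`. -/
structure POVM (K W : Type) [Fintype K] [Fintype W] [DecidableEq W] where
  op : K → Op W
  posSemidef : ∀ k, (op k).PosSemidef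
  sum_eq_one : ∑ k, op k = 1

/-! ### Quantum circuits with advice -/

/-- A gate on the wires `W`: an arbitrary one-qubit or two-qubit unitary. -/
inductive Gate (W : Type) : Type
  | single (i : W) (U : Matrix.unitaryGroup Bool ℂ) : Gate W
  | double (i j : W) (hij : i ≠ j) (U : Matrix.unitaryGroup (Bool × Bool) ℂ) : Gate W

/-- The unitary on all wires that a gate stands for (identity on the wires it does not touch). -/
noncomputable def Gate.toOp {W : Type} [Fintype W] [DecidableEq W] : Gate W → Op W
  | .single i U => Matrix.of fun x y =>
      if ∀ w, w ≠ i → x w = y w then (U : Matrix Bool Bool ℂ) (x i) (y i) else 0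
  | .double i j _ U => Matrix.of fun x y =>
      if ∀ w, w ≠ i → w ≠ j → x w = y w then
        (U : Matrix (Bool × Bool) (Bool × Bool) ℂ) (x i, x j) (y i, y j) else 0

/-- The unitary of a list of gates; the head of the list is applied first. -/
noncomputable def gatesOp {W : Type} [Fintype W] [DecidableEq W] : List (Gate W) → Op W
  | [] => 1
  | g :: gs => gatesOp gs * g.toOp

/-- A quantum circuit with input qubits `I` and output qubits `O`, which besides its input gets
`adv` qubits in the state `advice` and `anc` qubits in the state `|0⟩`. After the gates, the
wires selected by `out` are output and all other wires are discarded. -/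
structure Circuit (I O : Type) where
  adv : ℕ
  anc : ℕ
  advice : Op (Fin adv)
  advice_density : IsDensity advice
  gates : List (Gate (I ⊕ Fin adv ⊕ Fin anc))
  out : O ↪ I ⊕ Fin adv ⊕ Fin anc

/-- The size of a circuit: number of gates plus number of wires (advice qubits included). -/
def Circuit.size {I O : Type} [Fintype I] (c : Circuit I O) : ℕ :=
  c.gates.length + (Fintype.card I + c.adv + c.anc)

/-- The quantum channel implemented by a circuit. -/
noncomputable def Circuit.run {I O : Type} [Fintype I] [DecidableEq I] [Fintype O]
    (c : Circuit I O) (ρ : Op I) : Op O :=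
  reduce c.out
    (gatesOp c.gates * tensor ρ (tensor c.advice (ketbra (ket fun _ => false))) *
      (gatesOp c.gates).conjTranspose)

/-- The function `f` is bounded by a polynomial. -/
def PolyBounded (f : ℕ → ℕ) : Prop :=
  ∃ P : Polynomial ℕ, ∀ κ, f κ ≤ P.eval κ

/-- `f` is negligible, that is `f κ = κ ^ (-ω(1))`. -/
def Negligible (f : ℕ → ℝ) : Prop :=
  SuperpolynomialDecay atTop (fun κ : ℕ => (κ : ℝ)) f

/-- `f = Õ(g)`: `f` is `O(g)` up to a power of the logarithm of `g`. -/
def IsSoftO (f g : ℕ → ℝ) : Prop :=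
  ∃ k : ℕ, f =O[atTop] fun m => g m * |Real.log (g m)| ^ k

/-! ### Strong computational indistinguishability -/

/-- A nonuniform quantum polynomial-time algorithm: a family of polynomial-size quantum circuits
with quantum advice, one for each value of the security parameter. -/
structure QPT (I O : ℕ → Type) [∀ κ, Fintype (I κ)] where
  circuit : ∀ κ, Circuit (I κ) (O κ)
  poly_size : PolyBounded fun κ => (circuit κ).size

/-- A nonuniform QPT distinguisher outputs a single bit. -/
abbrev Distinguisher (I : ℕ → Type) [∀ κ, Fintype (I κ)] : Type :=
  QPT I fun _ => Unit

/-- The probability that the distinguisher outputs `1` on the state `ρ`. -/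
noncomputable def Distinguisher.prOne {I : ℕ → Type} [∀ κ, Fintype (I κ)]
    [∀ κ, DecidableEq (I κ)] (D : Distinguisher I) (κ : ℕ) (ρ : Op (I κ)) : ℝ :=
  ((D.circuit κ).run ρ (fun _ => true) (fun _ => true)).re

/-- The families of states `ρ`, `σ` are strongly computationally indistinguishable with the
function `η`: every nonuniform QPT distinguisher has advantage at most `η κ` for all large `κ`. -/
def StronglyIndist {I : ℕ → Type} [∀ κ, Fintype (I κ)] [∀ κ, DecidableEq (I κ)]
    (η : ℕ → ℝ) (ρ σ : ∀ κ, Op (I κ)) : Prop :=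
  ∀ D : Distinguisher I, ∃ κ₀ : ℕ, ∀ κ, κ₀ ≤ κ →
    |D.prOne κ (ρ κ) - D.prOne κ (σ κ)| ≤ η κ

/-! ### The computational monogamy-of-entanglement game -/

/-- Bit strings of length `m`. -/
abbrev Bits (m : ℕ) : Type := Fin m → Bool

/-- The classical state of a random pair of bit strings. -/
noncomputable def pairState {q n : ℕ} (μ : PMF (Bits q × Bits n)) : Op (Fin q ⊕ Fin n) :=
  classicalState (μ.map fun pt => Sum.elim pt.1 pt.2)

/-- The distribution of `(p, θ*)` where `(p, _)` is drawn from `μ` and `θ*` is uniform and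
independent. -/
noncomputable def refresh {q n : ℕ} (μ : PMF (Bits q × Bits n)) : PMF (Bits q × Bits n) :=
  μ.bind fun pt => (PMF.uniformOfFintype (Bits n)).map fun θ => (pt.1, θ)

/-- A strategy for the game: an efficient preparation which on input `p` creates a state on
registers `A`, `B` of `n κ` qubits each and a register `C`, and an arbitrary measurement of `C`
for all values of `p` and `θ`. -/
structure Strategy (q n : ℕ → ℕ) where
  c : ℕ → ℕ
  prep : QPT (fun κ => Fin (q κ)) (fun κ => Fin (n κ) ⊕ Fin (n κ) ⊕ Fin (c κ))
  meas : ∀ κ, Bits (q κ) → Bits (n κ) → POVM (Bits (n κ)) (Fin (c κ))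

/-- The state of `ABC` after the preparation phase on input `p`. -/
noncomputable def Strategy.state {q n : ℕ → ℕ} (S : Strategy q n) (κ : ℕ) (p : Bits (q κ)) :
    Op (Fin (n κ) ⊕ Fin (n κ) ⊕ Fin (S.c κ)) :=
  (S.prep.circuit κ).run (ketbra (ket p))

/-- The probability of the outcomes `K_A = a`, `K_B = b`, `K_C = k` given `(p, θ)`, when `A` and
`B` are measured in the `θ`-basis and `C` with the POVM of the strategy. -/
noncomputable def Strategy.outcomeProb {q n : ℕ → ℕ} (S : Strategy q n) (κ : ℕ)
    (p : Bits (q κ)) (θ a b k : Bits (n κ)) : ℝ :=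
  (Matrix.trace
    (tensor (ketbra (basisKet θ a)) (tensor (ketbra (basisKet θ b)) ((S.meas κ p θ).op k)) *
      S.state κ p)).re

/-- The probability that `K_A = K_B = K_C` when `(p, θ)` is drawn from `Z κ`. -/
noncomputable def Strategy.winProb {q n : ℕ → ℕ} (S : Strategy q n)
    (Z : ∀ κ, PMF (Bits (q κ) × Bits (n κ))) (κ : ℕ) : ℝ :=
  ∑ pt : Bits (q κ) × Bits (n κ), (Z κ pt).toReal *
    ∑ k : Bits (n κ), S.outcomeProb κ pt.1 pt.2 k k k

end CompMOE

/-! The winning probability is compared with the acceptance probability of an efficient test of the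
registers `A` and `B` alone.

Measure every pair `(Aᵢ, Bᵢ)` in the Bell basis. The outcome tells which of the four Bell states
occurred; it is encoded by an error bit `uᵢ` and a mismatch bit `wᵢ`. Equal outcomes of `A` and `B`
in the basis `θ` are only possible for the patterns with `wᵢ = θᵢ ∧ uᵢ` for all `i`. The test accepts
if this holds and if in addition each of `r ≈ √n / 2` residue classes of positions contains an error
`uᵢ = 1` (`Accepts`).

* If `θ` is uniform and independent of the state, then the test accepts with probability at most
  `2 ^ (-r)`, because an accepted `θ` is determined at `r` or more positions (`card_accepts_le`,
  `sum_acceptOp_le`).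
* The test is efficient: Bell measurements consist of two-qubit gates, and the classical test is a
  straight-line program of linearly many Toffoli gates (`execute_testProgram`, `run_testCircuit`).
  By strong indistinguishability it therefore accepts with probability at most `2 ^ (-r) + η` for the
  actual `(p, θ)`.
* In each of the `2 ^ n` basis states `|k⟩_θ ⊗ |k⟩_θ` all consistent error patterns have amplitudes of
  the same modulus `2 ^ (-n / 2)`. The patterns that fail the test are error-free on some class of at
  least `n / r` positions, so they make up a fraction of at most `r 2 ^ (-n / r)` (`freeCount_le`). On
  their span, every measurement of `C` guesses `k` with at most this probability
  (`lowErr_conj_winOp_le`).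

A weighted Cauchy-Schwarz inequality combines the accepted and the failing patterns (`winOp_le`), with
the weight chosen so that the acceptance probability enters with coefficient `1` up to an error of
order `2 ^ (-√n / 2)`. -/

namespace CompMOE

open scoped Kronecker MatrixOrder

/-! ### Operators on subregisters -/

open Classical in
/-- A bit string on `W` is a bit string on the subregister `ι : V ↪ W` together with a bit string
on the remaining wires. -/
noncomputable def splitEquiv {V W : Type} (ι : V ↪ W) :
    (W → Bool) ≃ (V → Bool) × ({w // w ∉ Set.range ι} → Bool) :=
  (Equiv.piEquivPiSubtypeProd (· ∈ Set.range ι) fun _ => Bool).trans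
    (Equiv.prodCongr ((Equiv.ofInjective ι ι.injective).arrowCongr (Equiv.refl _)).symm
      (Equiv.refl _))

theorem splitEquiv_apply {V W : Type} (ι : V ↪ W) (x : W → Bool) :
    splitEquiv ι x = (x ∘ ι, fun w => x w.1) := rfl

/-- The operator `M ⊗ 1` on the register `W`, where `M` acts on the subregister `ι : V ↪ W`. -/
noncomputable def lift {V W : Type} [Fintype V] [Fintype W]
    [DecidableEq W] (ι : V ↪ W) (M : Op V) : Op W :=
  (M ⊗ₖ (1 : Op {w // w ∉ Set.range ι})).submatrix (splitEquiv ι) (splitEquiv ι)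

theorem lift_apply {V W : Type} [Fintype V] [Fintype W]
    [DecidableEq W] (ι : V ↪ W) (M : Op V) (x y : W → Bool) :
    lift ι M x y = if ∀ w, (∀ v, ι v ≠ w) → x w = y w then M (x ∘ ι) (y ∘ ι) else 0 := by
  have h : lift ι M x y = M (x ∘ ι) (y ∘ ι) *
      if (fun w : {w // w ∉ Set.range ι} => x w.1) = (fun w => y w.1) then 1 else 0 := rfl
  rw [h]
  simp only [funext_iff, Subtype.forall, Set.mem_range, not_exists, mul_ite, mul_one,
    mul_zero, ne_eq]

theorem lift_mul {V W : Type} [Fintype V] [Fintype W]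
    [DecidableEq V] [DecidableEq W] (ι : V ↪ W) (M N : Op V) : lift ι (M * N) = lift ι M * lift ι N := by
  rw [lift, lift, lift, Matrix.submatrix_mul_equiv, ← Matrix.mul_kronecker_mul, Matrix.one_mul]

theorem lift_conjTranspose {V W : Type} [Fintype V] [Fintype W]
    [DecidableEq W] (ι : V ↪ W) (M : Op V) :
    lift ι M.conjTranspose = (lift ι M).conjTranspose := by
  rw [lift, lift, Matrix.conjTranspose_submatrix, Matrix.conjTranspose_kronecker,
    Matrix.conjTranspose_one]

theorem lift_one {V W : Type} [Fintype V] [Fintype W] [DecidableEq V] [DecidableEq W] (ι : V ↪ W) : lift ι 1 = 1 := by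
  classical
  rw [lift, Matrix.one_kronecker_one, Matrix.submatrix_one_equiv]

theorem lift_add {V W : Type} [Fintype V] [Fintype W]
    [DecidableEq W] (ι : V ↪ W) (M N : Op V) : lift ι (M + N) = lift ι M + lift ι N := by
  rw [lift, Matrix.add_kronecker]; rfl

theorem lift_smul {V W : Type} [Fintype V] [Fintype W]
    [DecidableEq W] (ι : V ↪ W) (c : ℂ) (M : Op V) : lift ι (c • M) = c • lift ι M := by
  rw [lift, Matrix.smul_kronecker]; rfl

theorem lift_sub {V W : Type} [Fintype V] [Fintype W]
    [DecidableEq W] (ι : V ↪ W) (M N : Op V) : lift ι (M - N) = lift ι M - lift ι N := by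
  rw [sub_eq_add_neg, ← neg_one_smul ℂ N, lift_add, lift_smul, neg_one_smul, sub_eq_add_neg]

theorem posSemidef_lift {V W : Type} [Fintype V] [Fintype W]
    [DecidableEq W] (ι : V ↪ W) {M : Op V} (hM : M.PosSemidef) : (lift ι M).PosSemidef := by
  exact (hM.kronecker Matrix.PosSemidef.one).submatrix _

/-- Tracing out the complement of a subregister is adjoint to `lift`. -/
theorem trace_mul_reduce {V W : Type} [Fintype V] [Fintype W]
    [DecidableEq V] [DecidableEq W] (ι : V ↪ W) (M : Op V) (ρ : Op W) :
    (M * reduce ι ρ).trace = (lift ι M * ρ).trace := by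
  classical
  have h1 : ∀ a b, M a b * reduce ι ρ b a = ∑ x, ∑ y,
      if (∀ o, x (ι o) = b o) ∧ (∀ o, y (ι o) = a o) ∧ (∀ w, (∀ o, ι o ≠ w) → x w = y w)
      then M a b * ρ x y else 0 := by
    intro a b
    simp only [reduce, Matrix.of_apply, Finset.mul_sum, mul_ite, mul_zero]
  have h2 : ∀ x y : W → Bool, (∑ a : V → Bool, ∑ b : V → Bool,
      if (∀ o, x (ι o) = b o) ∧ (∀ o, y (ι o) = a o) ∧ (∀ w, (∀ o, ι o ≠ w) → x w = y w)
      then M a b * ρ x y else 0) = lift ι M y x * ρ x y := by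
    intro x y
    rw [Finset.sum_eq_single (y ∘ ι), Finset.sum_eq_single (x ∘ ι)]
    · simp [lift_apply, ite_mul, eq_comm]
    · intro b _ hb
      exact if_neg fun h => hb (funext fun o => (h.1 o).symm)
    · simp
    · intro a _ ha
      refine Finset.sum_eq_zero fun b _ => if_neg fun h => ha (funext fun o => (h.2.1 o).symm)
    · simp
  simp only [Matrix.trace, Matrix.diag_apply, Matrix.mul_apply, h1]
  calc _ = ∑ a : V → Bool, ∑ x : W → Bool, ∑ b : V → Bool, ∑ y : W → Bool, _ :=
        Finset.sum_congr rfl fun a _ => Finset.sum_comm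
    _ = ∑ x : W → Bool, ∑ a : V → Bool, ∑ b : V → Bool, ∑ y : W → Bool, _ := Finset.sum_comm
    _ = ∑ x : W → Bool, ∑ a : V → Bool, ∑ y : W → Bool, ∑ b : V → Bool, _ :=
        Finset.sum_congr rfl fun x _ => Finset.sum_congr rfl fun a _ => Finset.sum_comm
    _ = ∑ x : W → Bool, ∑ y : W → Bool, ∑ a : V → Bool, ∑ b : V → Bool, _ :=
        Finset.sum_congr rfl fun x _ => Finset.sum_comm
    _ = ∑ x : W → Bool, ∑ y : W → Bool, lift ι M y x * ρ x y :=
        Finset.sum_congr rfl fun x _ => Finset.sum_congr rfl fun y _ => h2 x y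
    _ = _ := Finset.sum_comm

/-- The state `σ ⊗ |t⟩⟨t|` on the register `W`, where `σ` is a state of the subregister `ι : V ↪ W`
and the remaining wires are in the basis state given by `t` (whose values on the subregister
do not matter). -/
noncomputable def pad {V W : Type} [Fintype V] [Fintype W]
    [DecidableEq W] (ι : V ↪ W) (t : W → Bool) (σ : Op V) : Op W :=
  (σ ⊗ₖ (Matrix.single (fun w => t w) (fun w => t w) 1 :
    Op {w // w ∉ Set.range ι})).submatrix (splitEquiv ι) (splitEquiv ι)

theorem pad_apply {V W : Type} [Fintype V] [Fintype W]
    [DecidableEq W] (ι : V ↪ W) (t : W → Bool) (σ : Op V) (x y : W → Bool) :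
    pad ι t σ x y = if ∀ w, (∀ v, ι v ≠ w) → x w = t w ∧ y w = t w
      then σ (x ∘ ι) (y ∘ ι) else 0 := by
  simp only [pad, Matrix.submatrix_apply, splitEquiv_apply, Matrix.kronecker_apply,
    Matrix.single_apply, funext_iff, Subtype.forall, Set.mem_range, not_exists, mul_ite, mul_one,
    mul_zero, ne_eq]
  congr 1
  simp only [eq_iff_iff]
  exact ⟨fun h w hw => ⟨(h.1 w hw).symm, (h.2 w hw).symm⟩,
    fun h => ⟨fun w hw => (h w hw).1.symm, fun w hw => (h w hw).2.symm⟩⟩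

theorem lift_mul_pad_mul {V W : Type} [Fintype V] [Fintype W]
    [DecidableEq V] [DecidableEq W] (ι : V ↪ W) (t : W → Bool) (M σ : Op V) :
    lift ι M * pad ι t σ * (lift ι M).conjTranspose = pad ι t (M * σ * M.conjTranspose) := by
  rw [← lift_conjTranspose, lift, lift, pad, pad, Matrix.submatrix_mul_equiv,
    Matrix.submatrix_mul_equiv, ← Matrix.mul_kronecker_mul, ← Matrix.mul_kronecker_mul,
    Matrix.one_mul, Matrix.mul_one]

/-- The bit string that is `x` on the subregister `ι : V ↪ W` and `t` on the remaining wires. -/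
noncomputable def extend {V W : Type} (ι : V ↪ W) (t : W → Bool) (x : V → Bool) : W → Bool :=
  (splitEquiv ι).symm (x, fun w => t w)

theorem extend_apply {V W : Type} (ι : V ↪ W) (t : W → Bool) (x : V → Bool) (v : V) :
    extend ι t x (ι v) = x v := by
  have h := splitEquiv_apply ι (extend ι t x)
  rw [extend, Equiv.apply_symm_apply, Prod.mk.injEq] at h
  exact (congrFun h.1 v).symm

theorem extend_apply_of_notMem {V W : Type} (ι : V ↪ W) (t : W → Bool) (x : V → Bool) {w : W}
    (hw : w ∉ Set.range ι) : extend ι t x w = t w := by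
  have h := splitEquiv_apply ι (extend ι t x)
  rw [extend, Equiv.apply_symm_apply, Prod.mk.injEq] at h
  exact (congrFun h.2 ⟨w, hw⟩).symm

theorem sum_pad {V W : Type} [Fintype V] [Fintype W]
    [DecidableEq V] [DecidableEq W] (ι : V ↪ W) (t : W → Bool) (σ : Op V)
    (P : (W → Bool) → Prop) [DecidablePred P] :
    (∑ x, if P x then pad ι t σ x x else 0) =
      ∑ x, if P (extend ι t x) then σ x x else 0 := by
  rw [← (splitEquiv ι).symm.sum_comp, Fintype.sum_prod_type]
  refine Finset.sum_congr rfl fun x _ => ?_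
  have h : ∀ b, pad ι t σ ((splitEquiv ι).symm (x, b)) ((splitEquiv ι).symm (x, b)) =
      σ x x * if (fun w => t w.1) = b ∧ (fun w => t w.1) = b then 1 else 0 := by
    intro b
    simp only [pad, Matrix.submatrix_apply, Equiv.apply_symm_apply]
    rfl
  refine (Finset.sum_eq_single (fun w => t w.1) (fun b _ hb => ?_) (by simp)).trans ?_
  · rw [h, if_neg fun h' : _ ∧ _ => hb h'.1.symm]
    simp
  · rw [h]
    simp only [and_self, if_true, mul_one]
    rfl

/-- The trace of the product of two positive semidefinite matrices is nonnegative. -/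
theorem trace_mul_nonneg {m : Type} [Fintype m] {A B : Matrix m m ℂ}
    (hA : A.PosSemidef) (hB : B.PosSemidef) : 0 ≤ (A * B).trace := by
  classical
  obtain ⟨C, rfl⟩ := CStarAlgebra.nonneg_iff_eq_star_mul_self.mp hA.nonneg
  rw [Matrix.mul_assoc, Matrix.trace_mul_comm]
  exact (hB.mul_mul_conjTranspose_same C).trace_nonneg

theorem trace_mul_mono {m : Type} [Fintype m] {A B ρ : Matrix m m ℂ}
    (h : A ≤ B) (hρ : ρ.PosSemidef) : (A * ρ).trace.re ≤ (B * ρ).trace.re := by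
  have := trace_mul_nonneg (Matrix.le_iff.mp h) hρ
  rw [Matrix.sub_mul, Matrix.trace_sub, sub_nonneg] at this
  exact (Complex.le_def.mp this).1

/-- `|v⟩⟨v|` is at most the squared norm of `v`. -/
theorem vecMulVec_le {m : Type} [Fintype m] [DecidableEq m] (v : m → ℂ) :
    Matrix.vecMulVec v (star v) ≤ (star v ⬝ᵥ v) • (1 : Matrix m m ℂ) := by
  set s : ℂ := star v ⬝ᵥ v with hs
  set K := Matrix.vecMulVec v (star v)
  have hs0 : 0 ≤ s := dotProduct_star_self_nonneg v
  have hK : K.PosSemidef := Matrix.posSemidef_vecMulVec_self_star v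
  have hKK : K * K = s • K := by
    simp only [K, Matrix.vecMulVec_mul_vecMulVec, hs]
    ext i j
    simp [Matrix.vecMulVec_apply]
    ring
  rw [Matrix.le_iff]
  rcases eq_or_ne s 0 with h | h
  · have hv : v = 0 := dotProduct_star_self_eq_zero.mp h
    have : K = 0 := by simp [K, hv]
    rw [h, this]
    simpa using Matrix.PosSemidef.zero
  · -- `s - K` is a multiple of its own square, because `K / s` is a projector
    have hsq : (s • (1 : Matrix m m ℂ) - K) = s⁻¹ •
        ((s • (1 : Matrix m m ℂ) - K).conjTranspose * (s • (1 : Matrix m m ℂ) - K)) := by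
      have hst : star s = s := (IsSelfAdjoint.of_nonneg hs0)
      rw [Matrix.conjTranspose_sub, hK.1.eq, Matrix.conjTranspose_smul, hst,
        Matrix.conjTranspose_one]
      simp only [Matrix.sub_mul, Matrix.mul_sub, smul_mul_assoc, mul_smul_comm, one_mul, mul_one,
        hKK, sub_self, sub_zero, smul_smul, inv_mul_cancel₀ h, one_smul]
    rw [hsq]
    exact (Matrix.posSemidef_conjTranspose_mul_self _).smul (inv_nonneg.mpr hs0)

/-! ### Gates and gate lists -/

section Gates

variable {V W : Type}

/-- The gate on a larger register obtained by renaming the wires. -/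
def Gate.map (ι : V ↪ W) : Gate V → Gate W
  | .single i U => .single (ι i) U
  | .double i j hij U => .double (ι i) (ι j) (fun h => hij (ι.injective h)) U

theorem Gate.toOp_map [Fintype V] [Fintype W] [DecidableEq V] [DecidableEq W] (ι : V ↪ W)
    (g : Gate V) : (g.map ι).toOp = lift ι g.toOp := by
  ext x y
  rw [lift_apply]
  by_cases h : ∀ w, (∀ v, ι v ≠ w) → x w = y w
  · rw [if_pos h]
    cases g with
    | single i U =>
      simp only [Gate.map, Gate.toOp, Matrix.of_apply, Function.comp_apply]
      refine if_congr ⟨fun h' v hv => h' _ fun e => hv (ι.injective e), fun h' w hw => ?_⟩ rfl rfl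
      by_cases hv : ∃ v, ι v = w
      · obtain ⟨v, rfl⟩ := hv
        exact h' v fun e => hw (by rw [e])
      · exact h w fun v e => hv ⟨v, e⟩
    | double i j hij U =>
      simp only [Gate.map, Gate.toOp, Matrix.of_apply, Function.comp_apply]
      refine if_congr ⟨fun h' v hv hv' => h' _ (fun e => hv (ι.injective e))
        fun e => hv' (ι.injective e), fun h' w hw hw' => ?_⟩ rfl rfl
      by_cases hv : ∃ v, ι v = w
      · obtain ⟨v, rfl⟩ := hv
        exact h' v (fun e => hw (by rw [e])) fun e => hw' (by rw [e])
      · exact h w fun v e => hv ⟨v, e⟩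
  · rw [if_neg h]
    cases g with
    | single i U =>
      simp only [Gate.map, Gate.toOp, Matrix.of_apply]
      exact if_neg fun h' => h fun w hw => h' w fun e => hw _ e.symm
    | double i j hij U =>
      simp only [Gate.map, Gate.toOp, Matrix.of_apply]
      exact if_neg fun h' => h fun w hw => h' w (fun e => hw _ e.symm) fun e => hw _ e.symm

variable [Fintype W] [DecidableEq W]

theorem gatesOp_append (l l' : List (Gate W)) :
    gatesOp (l ++ l') = gatesOp l' * gatesOp l := by
  induction l with
  | nil => simp [gatesOp]
  | cons g l ih => rw [List.cons_append, gatesOp, ih, gatesOp, Matrix.mul_assoc]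

theorem gatesOp_map [Fintype V] [DecidableEq V] (ι : V ↪ W) (l : List (Gate V)) :
    gatesOp (l.map (Gate.map ι)) = lift ι (gatesOp l) := by
  induction l with
  | nil => simp [gatesOp, lift_one]
  | cons g l ih => rw [List.map_cons, gatesOp, ih, gatesOp, lift_mul, Gate.toOp_map]

theorem single_mulVec (i : W) (U : Matrix.unitaryGroup Bool ℂ) (ψ : (W → Bool) → ℂ)
    (x : W → Bool) :
    ((Gate.single i U).toOp.mulVec ψ) x =
      ∑ b, (U : Matrix Bool Bool ℂ) (x i) b * ψ (Function.update x i b) := by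
  simp only [Matrix.mulVec, dotProduct, Gate.toOp, Matrix.of_apply, ite_mul, zero_mul]
  rw [← Finset.sum_filter]
  symm
  refine Finset.sum_bij' (fun b _ => Function.update x i b) (fun y _ => y i) ?_ ?_ ?_ ?_ ?_
  · intro b _
    simp only [Finset.mem_filter, Finset.mem_univ, true_and]
    intro w hw
    rw [Function.update_of_ne hw]
  · simp
  · simp
  · intro y hy
    simp only [Finset.mem_filter, Finset.mem_univ, true_and] at hy
    funext w
    by_cases hw : w = i
    · subst hw; simp
    · rw [Function.update_of_ne hw, hy w hw]
  · simp

theorem double_mulVec (i j : W) (hij : i ≠ j) (U : Matrix.unitaryGroup (Bool × Bool) ℂ)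
    (ψ : (W → Bool) → ℂ) (x : W → Bool) :
    ((Gate.double i j hij U).toOp.mulVec ψ) x =
      ∑ b, (U : Matrix (Bool × Bool) (Bool × Bool) ℂ) (x i, x j) b *
        ψ (Function.update (Function.update x i b.1) j b.2) := by
  simp only [Matrix.mulVec, dotProduct, Gate.toOp, Matrix.of_apply, ite_mul, zero_mul]
  rw [← Finset.sum_filter]
  symm
  refine Finset.sum_bij' (fun b _ => Function.update (Function.update x i b.1) j b.2)
    (fun y _ => (y i, y j)) ?_ ?_ ?_ ?_ ?_
  · intro b _
    simp only [Finset.mem_filter, Finset.mem_univ, true_and]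
    intro w hw hw'
    rw [Function.update_of_ne hw', Function.update_of_ne hw]
  · simp
  · intro b _
    simp [Function.update_of_ne hij]
  · intro y hy
    simp only [Finset.mem_filter, Finset.mem_univ, true_and] at hy
    funext w
    by_cases hw' : w = j
    · subst hw'; simp
    · rw [Function.update_of_ne hw']
      by_cases hw : w = i
      · subst hw; simp
      · rw [Function.update_of_ne hw, hy w hw hw']
  · intro b _
    simp [Function.update_of_ne hij]

end Gates

/-- Gates are unitary. -/
theorem Gate.toOp_conjTranspose_mul {W : Type} [Fintype W] [DecidableEq W] (g : Gate W) :
    g.toOp.conjTranspose * g.toOp = 1 := by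
  -- the adjoint is the gate of the inverse unitary, and both act on functions by averaging
  cases g with
  | single i U =>
    have h : (Gate.single i U).toOp.conjTranspose = (Gate.single i (star U)).toOp := by
      ext x y
      simp only [Matrix.conjTranspose_apply, Gate.toOp, Matrix.of_apply, apply_ite star, star_zero]
      refine if_congr ⟨fun h w hw => (h w hw).symm, fun h w hw => (h w hw).symm⟩ ?_ rfl
      rfl
    have hU : ∀ a b, (∑ c, (star U : Matrix.unitaryGroup Bool ℂ) a c *
        (U : Matrix Bool Bool ℂ) c b) = (1 : Matrix Bool Bool ℂ) a b := fun a b => by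
      rw [← Matrix.mul_apply]
      exact congrFun (congrFun (Unitary.coe_star_mul_self U) a) b
    rw [h]
    refine Matrix.ext_of_mulVec_single fun y => ?_
    rw [← Matrix.mulVec_mulVec, Matrix.one_mulVec]
    funext x
    rw [single_mulVec]
    simp only [single_mulVec, Function.update_self, Function.update_idem, Finset.mul_sum]
    rw [Finset.sum_comm]
    simp only [← mul_assoc, ← Finset.sum_mul, hU, Matrix.one_apply, ite_mul, one_mul, zero_mul]
    simp
  | double i j hij U =>
    have h : (Gate.double i j hij U).toOp.conjTranspose =
        (Gate.double i j hij (star U)).toOp := by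
      ext x y
      simp only [Matrix.conjTranspose_apply, Gate.toOp, Matrix.of_apply, apply_ite star, star_zero]
      refine if_congr ⟨fun h w hw hw' => (h w hw hw').symm,
        fun h w hw hw' => (h w hw hw').symm⟩ ?_ rfl
      rfl
    have hU : ∀ a b, (∑ c, (star U : Matrix.unitaryGroup (Bool × Bool) ℂ) a c *
        (U : Matrix (Bool × Bool) (Bool × Bool) ℂ) c b) =
        (1 : Matrix (Bool × Bool) (Bool × Bool) ℂ) a b := fun a b => by
      rw [← Matrix.mul_apply]
      exact congrFun (congrFun (Unitary.coe_star_mul_self U) a) b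
    rw [h]
    refine Matrix.ext_of_mulVec_single fun y => ?_
    rw [← Matrix.mulVec_mulVec, Matrix.one_mulVec]
    funext x
    have hup : ∀ b c : Bool × Bool, Function.update (Function.update (Function.update
        (Function.update x i b.1) j b.2) i c.1) j c.2 =
        Function.update (Function.update x i c.1) j c.2 := by
      intro b c
      funext w
      simp only [Function.update_apply]
      split_ifs <;> rfl
    rw [double_mulVec]
    simp only [double_mulVec, Function.update_self, Function.update_of_ne hij, hup,
      Finset.mul_sum]
    rw [Finset.sum_comm]
    simp only [← mul_assoc, ← Finset.sum_mul, hU, Matrix.one_apply, ite_mul, one_mul, zero_mul]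
    simp

theorem gatesOp_conjTranspose_mul {W : Type} [Fintype W] [DecidableEq W] (l : List (Gate W)) :
    (gatesOp l).conjTranspose * gatesOp l = 1 := by
  induction l with
  | nil => simp [gatesOp]
  | cons g l ih =>
    rw [gatesOp, Matrix.conjTranspose_mul, Matrix.mul_assoc, ← Matrix.mul_assoc _ (gatesOp l),
      ih, Matrix.one_mul, g.toOp_conjTranspose_mul]

theorem gatesOp_mul_conjTranspose {W : Type} [Fintype W] [DecidableEq W] (l : List (Gate W)) :
    gatesOp l * (gatesOp l).conjTranspose = 1 :=
  mul_eq_one_comm.mp (gatesOp_conjTranspose_mul l)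

/-! ### Toffoli gates from two-qubit gates -/

/-- The two-qubit unitary that applies `U` to the second qubit if the first qubit is `s`. -/
def controlled (s : Bool) (U : Matrix.unitaryGroup Bool ℂ) :
    Matrix.unitaryGroup (Bool × Bool) ℂ :=
  ⟨Matrix.of fun a b => if a.1 = b.1 then
      ((if a.1 = s then U else 1 : Matrix.unitaryGroup Bool ℂ) : Matrix Bool Bool ℂ) a.2 b.2
      else 0, by
    rw [Matrix.mem_unitaryGroup_iff]
    have hU : ∀ (V : Matrix.unitaryGroup Bool ℂ) (a b : Bool),
        (∑ c, (V : Matrix Bool Bool ℂ) a c * star ((V : Matrix Bool Bool ℂ) b c)) =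
          (1 : Matrix Bool Bool ℂ) a b := fun V a b => by
      rw [← Matrix.mem_unitaryGroup_iff.mp V.2, Matrix.mul_apply]
      rfl
    ext ⟨a, a'⟩ ⟨b, b'⟩
    rw [Matrix.mul_apply, Fintype.sum_prod_type]
    simp only [Matrix.star_apply, Matrix.of_apply]
    by_cases hab : a = b
    · subst hab
      rw [Finset.sum_eq_single a (fun c _ hc => by simp [Ne.symm hc]) (by simp)]
      simp only [if_true]
      rw [hU]
      simp [Matrix.one_apply]
    · rw [Matrix.one_apply_ne (by simp [hab])]
      refine Finset.sum_eq_zero fun c _ => Finset.sum_eq_zero fun c' _ => ?_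
      by_cases h : a = c
      · simp [h ▸ Ne.symm hab]
      · simp [h]⟩

theorem controlled_mulVec {W : Type} [Fintype W] [DecidableEq W] (s : Bool)
    (U : Matrix.unitaryGroup Bool ℂ) (i j : W) (hij : i ≠ j) (ψ : (W → Bool) → ℂ)
    (x : W → Bool) :
    ((Gate.double i j hij (controlled s U)).toOp.mulVec ψ) x =
      if x i = s then ∑ b, (U : Matrix Bool Bool ℂ) (x j) b * ψ (Function.update x j b)
      else ψ x := by
  rw [double_mulVec, Fintype.sum_prod_type, Finset.sum_eq_single (x i)]
  · simp only [controlled, Matrix.of_apply, if_true, Function.update_eq_self]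
    split_ifs with h
    · rfl
    · simp [Matrix.one_apply]
  · intro b _ hb
    exact Finset.sum_eq_zero fun c _ => by simp [controlled, Ne.symm hb]
  · simp

/-- The one-qubit NOT gate. -/
def notGate : Matrix.unitaryGroup Bool ℂ :=
  ⟨Matrix.of fun a b => if a = b then 0 else 1, by
    rw [Matrix.mem_unitaryGroup_iff]
    ext a b
    cases a <;> cases b <;> simp [Matrix.mul_apply, Matrix.star_apply]⟩

theorem controlled_not_mulVec {W : Type} [Fintype W] [DecidableEq W] (s : Bool) (i j : W)
    (hij : i ≠ j) (ψ : (W → Bool) → ℂ) :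
    (Gate.double i j hij (controlled s notGate)).toOp.mulVec ψ =
      fun x => if x i = s then ψ (Function.update x j (!x j)) else ψ x := by
  funext x
  rw [controlled_mulVec]
  refine if_congr Iff.rfl ?_ rfl
  cases x j <;> simp [notGate]

/-- A square root of the NOT gate. -/
noncomputable def sqrtNotGate : Matrix.unitaryGroup Bool ℂ :=
  ⟨Matrix.of fun a b => if a = b then ⟨1 / 2, 1 / 2⟩ else ⟨1 / 2, -1 / 2⟩, by
    rw [Matrix.mem_unitaryGroup_iff]
    ext a b
    cases a <;> cases b <;>
      simp [Matrix.mul_apply, Matrix.star_apply, Complex.ext_iff] <;> norm_num⟩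

/-- One step of a classical reversible program: the bit on wire `tgt` is flipped if the bits on the
wires `ctrl₁`, `ctrl₂` have the values `val₁`, `val₂`. -/
structure Instr (W : Type) where
  ctrl₁ : W
  val₁ : Bool
  ctrl₂ : W
  val₂ : Bool
  tgt : W
  ne₁₂ : ctrl₁ ≠ ctrl₂
  ne₁ : ctrl₁ ≠ tgt
  ne₂ : ctrl₂ ≠ tgt

namespace Instr

variable {W : Type} [DecidableEq W]

/-- The effect of an instruction on a bit string. -/
def apply (c : Instr W) (x : W → Bool) : W → Bool :=
  Function.update x c.tgt (x c.tgt ^^ (x c.ctrl₁ == c.val₁ && x c.ctrl₂ == c.val₂))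

theorem apply_tgt (c : Instr W) (x : W → Bool) :
    c.apply x c.tgt = (x c.tgt ^^ (x c.ctrl₁ == c.val₁ && x c.ctrl₂ == c.val₂)) := by
  simp [apply]

theorem apply_of_ne (c : Instr W) (x : W → Bool) {w : W} (h : c.tgt ≠ w) :
    c.apply x w = x w := by
  simp [apply, Function.update_of_ne (Ne.symm h)]

theorem apply_apply (c : Instr W) (x : W → Bool) : c.apply (c.apply x) = x := by
  funext w
  by_cases h : c.tgt = w
  · subst h
    rw [apply_tgt, apply_of_ne _ _ c.ne₁.symm, apply_of_ne _ _ c.ne₂.symm, apply_tgt]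
    simp
  · rw [apply_of_ne _ _ h, apply_of_ne _ _ h]

/-- An instruction as a list of two-qubit gates. -/
noncomputable def gates (c : Instr W) : List (Gate W) :=
  [.double c.ctrl₂ c.tgt c.ne₂ (controlled c.val₂ sqrtNotGate),
    .double c.ctrl₁ c.ctrl₂ c.ne₁₂ (controlled c.val₁ notGate),
    .double c.ctrl₂ c.tgt c.ne₂ (controlled c.val₂ (star sqrtNotGate)),
    .double c.ctrl₁ c.ctrl₂ c.ne₁₂ (controlled c.val₁ notGate),
    .double c.ctrl₁ c.tgt c.ne₁ (controlled c.val₁ sqrtNotGate)]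

theorem gates_mulVec [Fintype W] (c : Instr W) (ψ : (W → Bool) → ℂ) (x : W → Bool) :
    (gatesOp c.gates).mulVec ψ x = ψ (c.apply x) := by
  obtain ⟨i, s, j, t, k, hij, hik, hjk⟩ := c
  have hkj := hjk.symm
  -- flipping the second control undoes itself, also across a change of the target
  have e1 : ∀ b, Function.update (Function.update (Function.update x k b) j (!x j)) j (x j) =
      Function.update x k b := by
    intro b
    rw [Function.update_idem, Function.update_comm hkj, Function.update_eq_self]
  have e2 : ∀ b b', Function.update (Function.update (Function.update (Function.update x k b) j
      (!x j)) k b') j (x j) = Function.update x k b' := by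
    intro b b'
    funext w
    simp only [Function.update_apply]
    split_ifs with h1 h2 <;> first | rfl | simp_all
  have hVV : ∀ a (f : Bool → ℂ), (∑ b, (sqrtNotGate : Matrix Bool Bool ℂ) a b *
      ∑ b', (sqrtNotGate : Matrix Bool Bool ℂ) b b' * f b') = f (!a) := by
    intro a f
    cases a <;> simp [sqrtNotGate, Complex.ext_iff] <;> constructor <;> ring
  have hVs : ∀ a (f : Bool → ℂ), (∑ b, (sqrtNotGate : Matrix Bool Bool ℂ) a b *
      ∑ b', (star sqrtNotGate : Matrix.unitaryGroup Bool ℂ) b b' * f b') = f a := by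
    intro a f
    cases a <;> simp [sqrtNotGate, Matrix.star_apply, Complex.ext_iff] <;> constructor <;> ring
  have hsV : ∀ a (f : Bool → ℂ), (∑ b, (star sqrtNotGate : Matrix.unitaryGroup Bool ℂ) a b *
      ∑ b', (sqrtNotGate : Matrix Bool Bool ℂ) b b' * f b') = f a := by
    intro a f
    cases a <;> simp [sqrtNotGate, Matrix.star_apply, Complex.ext_iff] <;> constructor <;> ring
  simp only [gates, gatesOp, Matrix.one_mul, ← Matrix.mulVec_mulVec, controlled_not_mulVec]
  simp only [controlled_mulVec, apply]
  by_cases hi : x i = s <;> by_cases hj : x j = t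
  · subst hj
    have hj' : ¬ (!x j) = x j := by simp
    have h : (x k ^^ (x i == s && x j == x j)) = !x k := by simp [hi]
    rw [h]
    simp only [hi, hj', hij, hik, hjk, hkj, Function.update_of_ne, ne_eq, not_false_eq_true,
      Function.update_self, if_true, if_false, Bool.not_not, e1, Function.update_idem, hVV]
  · obtain rfl : (!x j) = t := by revert hj; cases x j <;> cases t <;> simp
    have h : (x k ^^ (x i == s && x j == !x j)) = x k := by simp
    rw [h, Function.update_eq_self]
    simp only [hi, hj, hij, hik, hjk, hkj, Function.update_of_ne, ne_eq, not_false_eq_true,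
      Function.update_self, if_true, if_false, Bool.not_not, e2, hVs, Function.update_eq_self]
  · have h : (x k ^^ (x i == s && x j == t)) = x k := by rw [beq_false_of_ne hi]; simp
    rw [h, Function.update_eq_self]
    simp only [hi, hj, hij, hik, hjk, hkj, Function.update_of_ne, ne_eq, not_false_eq_true,
      Function.update_self, if_true, if_false, Function.update_idem, hsV, Function.update_eq_self]
  · have h : (x k ^^ (x i == s && x j == t)) = x k := by rw [beq_false_of_ne hj]; simp
    rw [h, Function.update_eq_self]
    simp only [hi, hj, if_false]

end Instr

/-! ### Classical reversible programs -/

section Programs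

variable {V W : Type} [DecidableEq V] [DecidableEq W]

/-- The effect of a list of instructions, the head of the list being executed first. -/
def execute (l : List (Instr W)) (x : W → Bool) : W → Bool :=
  l.foldl (fun y c => c.apply y) x

theorem execute_nil (x : W → Bool) : execute [] x = x := rfl

theorem execute_cons (c : Instr W) (l : List (Instr W)) (x : W → Bool) :
    execute (c :: l) x = execute l (c.apply x) := rfl

theorem execute_injective (l : List (Instr W)) : Function.Injective (execute l) := by
  induction l with
  | nil => exact fun _ _ h => h
  | cons c l ih =>
    intro x y h
    have h' : c.apply x = c.apply y := ih h
    rw [← c.apply_apply x, h', c.apply_apply]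

theorem execute_mulVec [Fintype W] (l : List (Instr W)) (ψ : (W → Bool) → ℂ) (x : W → Bool) :
    (gatesOp (l.flatMap Instr.gates)).mulVec ψ (execute l x) = ψ x := by
  induction l generalizing ψ x with
  | nil => simp [gatesOp, execute_nil]
  | cons c l ih =>
    rw [List.flatMap_cons, gatesOp_append, ← Matrix.mulVec_mulVec, execute_cons, ih,
      c.gates_mulVec, c.apply_apply]

theorem gatesOp_program_conj_diag [Fintype W] (l : List (Instr W)) (ρ : Op W) (x : W → Bool) :
    (gatesOp (l.flatMap Instr.gates) * ρ * (gatesOp (l.flatMap Instr.gates)).conjTranspose)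
      (execute l x) (execute l x) = ρ x x := by
  set P := gatesOp (l.flatMap Instr.gates)
  have hP : ∀ y, P (execute l x) y = if x = y then 1 else 0 := by
    intro y
    have h := execute_mulVec l (Pi.single y 1) x
    rw [Matrix.mulVec_single_one] at h
    exact h.trans (by simp [Pi.single_apply])
  rw [Matrix.mul_apply]
  simp [Matrix.mul_apply, hP, apply_ite star]

/-- Measuring a wire after a reversible program amounts to measuring all wires before and running
the program on the outcome. -/
theorem sum_program_conj_diag [Fintype W] (l : List (Instr W)) (ρ : Op W) (w : W) :
    (∑ x, if x w = true then (gatesOp (l.flatMap Instr.gates) * ρ *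
      (gatesOp (l.flatMap Instr.gates)).conjTranspose) x x else 0) =
    ∑ x, if execute l x w = true then ρ x x else 0 := by
  symm
  refine Fintype.sum_bijective (execute l) (Finite.injective_iff_bijective.mp
    (execute_injective l)) _ _ fun x => ?_
  rw [gatesOp_program_conj_diag]

theorem execute_of_ne {l : List (Instr W)} {w : W} (h : ∀ c ∈ l, c.tgt ≠ w) (x : W → Bool) :
    execute l x w = x w := by
  induction l generalizing x with
  | nil => rfl
  | cons c l ih =>
    rw [execute_cons, ih (fun c' hc' => h c' (List.mem_cons_of_mem _ hc')),
      c.apply_of_ne _ (h c List.mem_cons_self)]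

/-- If no wire used by an instruction is the target of a later instruction, then the final bit
string satisfies the equations that the instructions stand for. -/
theorem execute_tgt {l : List (Instr W)}
    (h : l.Pairwise fun c c' => c'.tgt ≠ c.ctrl₁ ∧ c'.tgt ≠ c.ctrl₂ ∧ c'.tgt ≠ c.tgt)
    (x : W → Bool) {c : Instr W} (hc : c ∈ l) :
    execute l x c.tgt =
      (x c.tgt ^^ (execute l x c.ctrl₁ == c.val₁ && execute l x c.ctrl₂ == c.val₂)) := by
  induction l generalizing x with
  | nil => simp at hc
  | cons d l ih =>
    rw [List.pairwise_cons] at h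
    rw [execute_cons]
    rcases List.mem_cons.mp hc with rfl | hc
    · rw [execute_of_ne fun c' hc' => (h.1 c' hc').1, execute_of_ne fun c' hc' => (h.1 c' hc').2.1,
        execute_of_ne fun c' hc' => (h.1 c' hc').2.2, c.apply_tgt, c.apply_of_ne _ c.ne₁.symm,
        c.apply_of_ne _ c.ne₂.symm]
    · rw [ih h.2 _ hc, d.apply_of_ne _ (h.1 c hc).2.2.symm]

/-- The instruction on a larger register obtained by renaming the wires. -/
def Instr.map (ω : V ↪ W) (c : Instr V) : Instr W where
  ctrl₁ := ω c.ctrl₁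
  val₁ := c.val₁
  ctrl₂ := ω c.ctrl₂
  val₂ := c.val₂
  tgt := ω c.tgt
  ne₁₂ h := c.ne₁₂ (ω.injective h)
  ne₁ h := c.ne₁ (ω.injective h)
  ne₂ h := c.ne₂ (ω.injective h)

theorem execute_map (ω : V ↪ W) (l : List (Instr V)) (x : W → Bool) (v : V) :
    execute (l.map (Instr.map ω)) x (ω v) = execute l (fun v => x (ω v)) v := by
  induction l generalizing x with
  | nil => rfl
  | cons c l ih =>
    rw [List.map_cons, execute_cons, execute_cons, ih]
    congr 1
    funext v
    by_cases h : c.tgt = v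
    · subst h
      rw [c.apply_tgt]
      exact (c.map ω).apply_tgt x
    · rw [c.apply_of_ne _ h, (c.map ω).apply_of_ne _ fun h' => h (ω.injective h')]

end Programs

theorem length_flatMap_gates {W : Type} (l : List (Instr W)) :
    (l.flatMap Instr.gates).length = 5 * l.length := by
  induction l with
  | nil => rfl
  | cons c l ih => simp [Instr.gates, ih]; ring

/-! ### The acceptance test as a program -/

/-- The acceptance test: at every position the mismatch bit `w` vanishes up to the correction
`θ ∧ u`, and each residue class modulo `r` contains a position with error bit `u`. -/
def Accepts {n : ℕ} (r : ℕ) (θ u w : Bits n) : Prop :=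
  (∀ i, w i = (θ i && u i)) ∧ ∀ j < r, ∃ i : Fin n, i.1 % r = j ∧ u i = true

/-- The wires of the acceptance test. -/
abbrev Reg (n r : ℕ) : Type := Fin n ⊕ Fin n ⊕ Fin n ⊕ Fin (n + r) ⊕ Fin (n + r + 1)

namespace Reg

variable {n r : ℕ}

/-- The input wire with the error bit of position `i`. -/
abbrev err (i : Fin n) : Reg n r := .inl i

/-- The input wire with the mismatch bit of position `i`. -/
abbrev mis (i : Fin n) : Reg n r := .inr (.inl i)

/-- The input wire with the basis choice at position `i`. -/
abbrev basis (i : Fin n) : Reg n r := .inr (.inr (.inl i))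

/-- The work wire which records, for `r ≤ j`, that there is no error at the positions before `j`
that are congruent to `j` modulo `r`. -/
abbrev free (j : Fin (n + r)) : Reg n r := .inr (.inr (.inr (.inl j)))

/-- The work wire which records that the first `j` conditions of the test hold. -/
abbrev ok (j : Fin (n + r + 1)) : Reg n r := .inr (.inr (.inr (.inr j)))

end Reg

open Reg

section TestProgram

variable {n r : ℕ}

/-- Replaces the mismatch bit `w` by `w + θ ∧ u`. -/
def misInstr (i : Fin n) : Instr (Reg n r) where
  ctrl₁ := basis i
  val₁ := true
  ctrl₂ := err i
  val₂ := true
  tgt := mis i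
  ne₁₂ := by simp
  ne₁ := by simp
  ne₂ := by simp

/-- Computes the bit `free (i + r)`. The bits `free i` with `i < r` keep their initial value `0`,
so that in this case the first control is always satisfied. -/
def freeInstr (hr : 0 < r) (i : Fin n) : Instr (Reg n r) where
  ctrl₁ := free ⟨i, by omega⟩
  val₁ := decide (r ≤ i.1)
  ctrl₂ := err i
  val₂ := false
  tgt := free ⟨i + r, by omega⟩
  ne₁₂ := by simp
  ne₁ := by simp; omega
  ne₂ := by simp

/-- The wire whose bit has to vanish for the `j`-th condition of the test. -/
def condWire (j : Fin (n + r)) : Reg n r :=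
  if h : j.1 < n then mis ⟨j, h⟩ else free j

/-- Computes the bit `ok (j + 1)`. The bit `ok 0` keeps its initial value `0`. -/
def okInstr (j : Fin (n + r)) : Instr (Reg n r) where
  ctrl₁ := ok j.castSucc
  val₁ := decide (0 < j.1)
  ctrl₂ := condWire j
  val₂ := false
  tgt := ok j.succ
  ne₁₂ := by unfold condWire; split_ifs <;> simp
  ne₁ := by simp [Fin.ext_iff]
  ne₂ := by unfold condWire; split_ifs <;> simp

/-- The acceptance test. -/
def testProgram (n : ℕ) {r : ℕ} (hr : 0 < r) : List (Instr (Reg n r)) :=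
  (List.finRange n).map misInstr ++
    ((List.finRange n).map (freeInstr hr) ++ (List.finRange (n + r)).map okInstr)

theorem length_testProgram (n : ℕ) {r : ℕ} (hr : 0 < r) :
    (testProgram n hr).length = 3 * n + r := by
  simp [testProgram]; ring

theorem pairwise_testProgram (n : ℕ) {r : ℕ} (hr : 0 < r) :
    (testProgram n hr).Pairwise
      fun c c' => c'.tgt ≠ c.ctrl₁ ∧ c'.tgt ≠ c.ctrl₂ ∧ c'.tgt ≠ c.tgt := by
  have hc : ∀ (j : Fin (n + r)) (k : Fin (n + r + 1)), ok k ≠ condWire j := by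
    intro j k
    unfold condWire
    split_ifs <;> simp
  refine List.pairwise_append.mpr ⟨?_, List.pairwise_append.mpr ⟨?_, ?_, ?_⟩, ?_⟩
  · rw [List.pairwise_map]
    refine (List.pairwise_lt_finRange n).imp fun {i j} h => ?_
    simp [misInstr, h.ne']
  · rw [List.pairwise_map]
    refine (List.pairwise_lt_finRange n).imp fun {i j} h => ?_
    have h' : i.1 < j.1 := h
    simp [freeInstr]
    omega
  · rw [List.pairwise_map]
    refine (List.pairwise_lt_finRange _).imp fun {i j} h => ?_
    have h' : i.1 < j.1 := h
    simp [okInstr, Fin.ext_iff, hc]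
    omega
  · simp [freeInstr, okInstr]
  · intro a ha b hb
    simp only [List.mem_map, List.mem_append, List.mem_finRange, true_and] at ha hb
    obtain ⟨i, rfl⟩ := ha
    rcases hb with ⟨j, rfl⟩ | ⟨j, rfl⟩ <;> simp [freeInstr, okInstr, misInstr]

/-- The program `testProgram` decides the acceptance test. The hypothesis `r ≤ n` excludes empty
residue classes, on which the program and `Accepts` differ. -/
theorem execute_testProgram (hr : 0 < r) (hrn : r ≤ n) (x : Reg n r → Bool) (hfree : ∀ j, x (free j) = false)
    (hok : ∀ j, x (ok j) = false) :
    execute (testProgram n hr) x (ok (Fin.last _)) = true ↔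
      Accepts r (fun i => x (basis i)) (fun i => x (err i)) (fun i => x (mis i)) := by
  set y := execute (testProgram n hr) x with hy
  have hmem : ∀ c, c ∈ testProgram n hr ↔ (∃ i, misInstr i = c) ∨ (∃ i, freeInstr hr i = c) ∨
      ∃ j, okInstr j = c := by
    intro c
    simp [testProgram]
  have hbasis : ∀ i, y (basis i) = x (basis i) := fun i => by
    refine execute_of_ne (fun c hc => ?_) x
    rcases (hmem c).mp hc with ⟨j, rfl⟩ | ⟨j, rfl⟩ | ⟨j, rfl⟩ <;>
      simp [misInstr, freeInstr, okInstr]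
  have herr : ∀ i, y (err i) = x (err i) := fun i => by
    refine execute_of_ne (fun c hc => ?_) x
    rcases (hmem c).mp hc with ⟨j, rfl⟩ | ⟨j, rfl⟩ | ⟨j, rfl⟩ <;>
      simp [misInstr, freeInstr, okInstr]
  have hfree0 : ∀ j : Fin (n + r), j.1 < r → y (free j) = false := fun j hj => by
    rw [← hfree j]
    refine execute_of_ne (fun c hc => ?_) x
    rcases (hmem c).mp hc with ⟨i, rfl⟩ | ⟨i, rfl⟩ | ⟨i, rfl⟩
    · simp [misInstr]
    · simp [freeInstr, Fin.ext_iff]; omega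
    · simp [okInstr]
  have hok0 : y (ok 0) = false := by
    rw [← hok 0]
    refine execute_of_ne (fun c hc => ?_) x
    rcases (hmem c).mp hc with ⟨i, rfl⟩ | ⟨i, rfl⟩ | ⟨i, rfl⟩
    · simp [misInstr]
    · simp [freeInstr]
    · simp [okInstr, Fin.ext_iff]
  have hspec : ∀ c ∈ testProgram n hr, y c.tgt =
      (x c.tgt ^^ (y c.ctrl₁ == c.val₁ && y c.ctrl₂ == c.val₂)) :=
    fun c hc => execute_tgt (pairwise_testProgram n hr) x hc
  have hmis : ∀ i, y (mis i) = (x (mis i) ^^ (x (basis i) && x (err i))) := fun i => by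
    have h := hspec (misInstr i) ((hmem _).mpr (.inl ⟨i, rfl⟩))
    simpa [misInstr, hbasis, herr] using h
  have hfreeS : ∀ i : Fin n, y (free ⟨i + r, by omega⟩) =
      (y (free ⟨i, by omega⟩) == decide (r ≤ i.1) && !x (err i)) := fun i => by
    have h := hspec (freeInstr hr i) ((hmem _).mpr (.inr (.inl ⟨i, rfl⟩)))
    simpa [freeInstr, hfree, herr] using h
  have hokS : ∀ j : Fin (n + r), y (ok j.succ) =
      (y (ok j.castSucc) == decide (0 < j.1) && !y (condWire j)) := fun j => by
    have h := hspec (okInstr j) ((hmem _).mpr (.inr (.inr ⟨j, rfl⟩)))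
    simpa [okInstr, hok] using h
  have hfreeIff : ∀ (m : ℕ) (hm : m < n + r), r ≤ m → (y (free ⟨m, hm⟩) = true ↔
      ∀ i : Fin n, i.1 < m → i.1 % r = m % r → x (err i) = false) := by
    intro m
    induction m using Nat.strong_induction_on with
    | _ m ih =>
      intro hm hrm
      obtain ⟨i, rfl⟩ : ∃ i, m = i + r := ⟨m - r, by omega⟩
      have hS := hfreeS ⟨i, by omega⟩
      have hprev : (y (free ⟨i, by omega⟩) == decide (r ≤ i)) = true ↔
          ∀ i' : Fin n, i'.1 < i → i'.1 % r = i % r → x (err i') = false := by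
        by_cases hri : r ≤ i
        · rw [decide_eq_true hri, beq_true, ih i (by omega) (by omega) hri]
        · rw [hfree0 _ (by simpa using hri), decide_eq_false hri]
          simp only [beq_self_eq_true, true_iff]
          intro i' hi' hmod
          rw [Nat.mod_eq_of_lt (by omega), Nat.mod_eq_of_lt (by omega)] at hmod
          omega
      rw [hS, Bool.and_eq_true, hprev, Nat.add_mod_right]
      constructor
      · rintro ⟨h1, h2⟩ i' hi' hmod
        by_cases hlt : i'.1 < i
        · exact h1 i' hlt hmod
        · by_cases heq : i'.1 = i
          · rw [show i' = ⟨i, by omega⟩ from Fin.ext heq]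
            simpa using h2
          · exfalso
            -- the next position congruent to `i` is `i + r`
            have h3 : (i'.1 - i) % r = 0 := Nat.sub_mod_eq_zero_of_mod_eq hmod
            rw [Nat.mod_eq_of_lt (by omega)] at h3
            omega
      · intro h
        refine ⟨fun i' hi' hmod => h i' (by omega) hmod, ?_⟩
        simpa using h ⟨i, by omega⟩ (by simp; omega) rfl
  have hokIff : ∀ (m : ℕ) (hm : m < n + r), (y (ok ⟨m + 1, by omega⟩) = true ↔
      ∀ j : Fin (n + r), j.1 ≤ m → y (condWire j) = false) := by
    intro m
    induction m with
    | zero =>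
      intro hm
      have h := hokS ⟨0, hm⟩
      have h0 : (⟨0, hm⟩ : Fin (n + r)).castSucc = 0 := rfl
      rw [h0, hok0] at h
      simp only [lt_irrefl, decide_false, beq_self_eq_true, Bool.true_and] at h
      rw [show (⟨0 + 1, by omega⟩ : Fin (n + r + 1)) = (⟨0, hm⟩ : Fin (n + r)).succ from rfl, h]
      simp only [Bool.not_eq_true']
      refine ⟨fun h j hj => ?_, fun h => h _ le_rfl⟩
      obtain rfl : j = ⟨0, hm⟩ := Fin.ext (by simpa using hj)
      exact h
    | succ m ih =>
      intro hm
      have h := hokS ⟨m + 1, hm⟩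
      rw [show (⟨m + 1 + 1, by omega⟩ : Fin (n + r + 1)) = (⟨m + 1, hm⟩ : Fin (n + r)).succ
        from rfl, h]
      rw [decide_eq_true (by simp : 0 < (⟨m + 1, hm⟩ : Fin (n + r)).1), beq_true,
        Bool.and_eq_true, show (⟨m + 1, hm⟩ : Fin (n + r)).castSucc = ⟨m + 1, by omega⟩ from rfl,
        ih (by omega)]
      simp only [Bool.not_eq_true']
      constructor
      · rintro ⟨h1, h2⟩ j hj
        rcases Nat.lt_or_ge m j.1 with hlt | hle
        · obtain rfl : j = ⟨m + 1, hm⟩ := Fin.ext (by simp; omega)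
          exact h2
        · exact h1 j hle
      · exact fun h => ⟨fun j hj => h j (by omega), h _ le_rfl⟩
  have hlast : (Fin.last (n + r)) = ⟨(n + r - 1) + 1, by omega⟩ := Fin.ext (by simp; omega)
  rw [hlast, hokIff _ (by omega)]
  constructor
  · intro h
    refine ⟨fun i => ?_, fun j hj => ?_⟩
    · have h1 := h ⟨i, by omega⟩ (by simp; omega)
      rw [condWire, dif_pos i.2] at h1
      have h2 := hmis i
      rw [show y (mis i) = false from h1] at h2
      exact (bne_eq_false_iff_eq.mp h2.symm)
    · -- the position in `[n, n + r)` that is congruent to `j`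
      obtain ⟨m, hm1, hm2, hm3⟩ : ∃ m, n ≤ m ∧ m < n + r ∧ m % r = j := by
        refine ⟨n + (j + r - n % r) % r, by omega, ?_, ?_⟩
        · have := Nat.mod_lt (j + r - n % r) hr; omega
        · have h1 := Nat.mod_lt n hr
          have h2 := Nat.div_add_mod n r
          have h3 : n + (j + r - n % r) = j + r * (n / r + 1) := by
            rw [Nat.mul_add, Nat.mul_one]; omega
          rw [Nat.add_mod, Nat.mod_mod, ← Nat.add_mod, h3, Nat.add_mul_mod_self_left,
            Nat.mod_eq_of_lt hj]
      have h1 := h ⟨m, hm2⟩ (by simp; omega)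
      rw [condWire, dif_neg (by simpa using hm1)] at h1
      by_contra hcon
      push Not at hcon
      have h2 := (hfreeIff m hm2 (hrn.trans hm1)).mpr fun i _ hi => by
        simpa using hcon i (hi.trans hm3)
      simp [h1] at h2
  · rintro ⟨h1, h2⟩ j -
    unfold condWire
    split_ifs with hj
    · rw [hmis, show x (mis ⟨j, hj⟩) = _ from h1 ⟨j, hj⟩]
      simp
    · obtain ⟨i, hi, hu⟩ := h2 (j.1 % r) (Nat.mod_lt _ hr)
      rw [← Bool.not_eq_true]
      intro h3
      have h4 := (hfreeIff j.1 j.2 (by omega)).mp h3 i (by omega) hi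
      simp [h4] at hu

end TestProgram

/-! ### Bell measurements -/

theorem sqrt_two_mul_self : (Real.sqrt 2 : ℂ) * (Real.sqrt 2 : ℂ) = 2 := by
  rw [← Complex.ofReal_mul, Real.mul_self_sqrt (by norm_num)]
  norm_num

/-- The two-qubit unitary that maps the Bell basis to the computational basis. The image of
`|Φ⁺⟩`, `|Φ⁻⟩`, `|Ψ⁺⟩`, `|Ψ⁻⟩` is `|00⟩`, `|10⟩`, `|11⟩`, `|01⟩`: the first bit is the parity of
the phase error and the bit error, the second bit is the bit error. -/
noncomputable def bellGate : Matrix.unitaryGroup (Bool × Bool) ℂ :=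
  ⟨Matrix.of fun x a => if (a.1 ^^ a.2) = x.2 then
      (if (x.1 ^^ x.2) && a.1 then -1 else 1) / (Real.sqrt 2 : ℂ) else 0, by
    have h2 := sqrt_two_mul_self
    have h0 : (Real.sqrt 2 : ℂ) ≠ 0 := fun h => by simp [h] at h2
    rw [Matrix.mem_unitaryGroup_iff]
    ext ⟨a, a'⟩ ⟨b, b'⟩
    rw [Matrix.mul_apply, Fintype.sum_prod_type]
    cases a <;> cases a' <;> cases b <;> cases b' <;>
      simp [Matrix.star_apply] <;> field_simp <;>
      first | ring1 | linear_combination h2 | linear_combination -h2⟩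

/-- The amplitude of `|u, w⟩` in the image under the Bell measurement of the two-qubit state
in which both qubits are in the state `H^θ|k⟩`. -/
noncomputable def bellAmp (θ k u w : Bool) : ℂ :=
  if w = (θ && u) then (if k && u then -1 else 1) / (Real.sqrt 2 : ℂ) else 0

theorem bellGate_basis (θ k u w : Bool) :
    (∑ b : Bool × Bool, (bellGate : Matrix (Bool × Bool) (Bool × Bool) ℂ) (u, w) b *
      ((if θ then hadamardGate else 1) b.1 k * (if θ then hadamardGate else 1) b.2 k)) =
    bellAmp θ k u w := by
  have h2 := sqrt_two_mul_self
  have h0 : (Real.sqrt 2 : ℂ) ≠ 0 := fun h => by simp [h] at h2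
  rw [Fintype.sum_prod_type]
  cases θ <;> cases k <;> cases u <;> cases w <;>
    simp [bellGate, bellAmp, hadamardGate] <;> field_simp <;>
      first | ring1 | linear_combination h2 | linear_combination -h2

theorem normSq_bellAmp (θ k u w : Bool) :
    star (bellAmp θ k u w) * bellAmp θ k u w = if w = (θ && u) then 1 / 2 else 0 := by
  have h2 := sqrt_two_mul_self
  have h0 : (Real.sqrt 2 : ℂ) ≠ 0 := fun h => by simp [h] at h2
  unfold bellAmp
  split_ifs <;> simp <;> field_simp <;>
      first | ring1 | linear_combination h2 | linear_combination -h2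

section WinningOperator

variable {n c : ℕ}

/-- The Bell measurement gates on the qubit pairs `(Aᵢ, Bᵢ)`. -/
noncomputable def bellGates (n c : ℕ) : List (Gate (Fin n ⊕ Fin n ⊕ Fin c)) :=
  (List.finRange n).map fun i => .double (.inl i) (.inr (.inl i)) (by simp) bellGate

/-- Bell gates map product vectors of the pairs `(Aᵢ, Bᵢ)` to product vectors. -/
theorem bellGates_mulVec_prod (l : List (Fin n)) (hl : l.Nodup) (f : Fin n → Bool × Bool → ℂ)
    (φ : Bits c → ℂ) :
    (gatesOp (l.map fun i => (Gate.double (.inl i) (.inr (.inl i)) (by simp) bellGate :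
      Gate (Fin n ⊕ Fin n ⊕ Fin c)))).mulVec (fun x => φ (fun j => x (.inr (.inr j))) *
        ∏ i, f i (x (.inl i), x (.inr (.inl i)))) =
    fun x => φ (fun j => x (.inr (.inr j))) * ∏ i, (if i ∈ l then
      (bellGate : Matrix (Bool × Bool) (Bool × Bool) ℂ).mulVec (f i) else f i)
        (x (.inl i), x (.inr (.inl i))) := by
  induction l generalizing f with
  | nil => simp [gatesOp]
  | cons i l ih =>
    rw [List.nodup_cons] at hl
    rw [List.map_cons, gatesOp, ← Matrix.mulVec_mulVec]
    have hi : (Gate.double (.inl i) (.inr (.inl i)) (by simp) bellGate :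
        Gate (Fin n ⊕ Fin n ⊕ Fin c)).toOp.mulVec (fun x => φ (fun j => x (.inr (.inr j))) *
          ∏ i, f i (x (.inl i), x (.inr (.inl i)))) =
        fun x => φ (fun j => x (.inr (.inr j))) * ∏ i', Function.update f i
          ((bellGate : Matrix (Bool × Bool) (Bool × Bool) ℂ).mulVec (f i)) i'
            (x (.inl i'), x (.inr (.inl i'))) := by
      funext x
      rw [double_mulVec, ← Finset.mul_prod_erase _ _ (Finset.mem_univ i), Function.update_self,
        Matrix.mulVec, dotProduct, Finset.sum_mul, Finset.mul_sum]
      refine Finset.sum_congr rfl fun b _ => ?_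
      rw [← Finset.mul_prod_erase _ _ (Finset.mem_univ i)]
      have hp : ∀ i' ∈ Finset.univ.erase i, Function.update f i
          ((bellGate : Matrix (Bool × Bool) (Bool × Bool) ℂ).mulVec (f i)) i'
            (x (.inl i'), x (.inr (.inl i'))) = f i' (x (.inl i'), x (.inr (.inl i'))) := by
        intro i' hi'
        rw [Function.update_of_ne (Finset.ne_of_mem_erase hi')]
      rw [Finset.prod_congr rfl hp]
      have hp' : ∀ i' ∈ Finset.univ.erase i, f i'
          (Function.update (Function.update x (.inl i) b.1) (.inr (.inl i)) b.2 (.inl i'),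
            Function.update (Function.update x (.inl i) b.1) (.inr (.inl i)) b.2
              (.inr (.inl i'))) = f i' (x (.inl i'), x (.inr (.inl i'))) := by
        intro i' hi'
        have := Finset.ne_of_mem_erase hi'
        simp [this]
      rw [Finset.prod_congr rfl hp']
      simp
      ring
    rw [hi, ih hl.2]
    funext x
    congr 1
    refine Finset.prod_congr rfl fun i' _ => ?_
    by_cases h : i' = i
    · subst h
      simp [hl.1]
    · simp [h]

/-- The unitary of the Bell measurement of all qubit pairs `(Aᵢ, Bᵢ)`. -/
noncomputable def bellOp (n c : ℕ) : Op (Fin n ⊕ Fin n ⊕ Fin c) :=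
  gatesOp (bellGates n c)

theorem bellOp_mulVec_basis (θ k : Bits n) (φ : Bits c → ℂ) :
    (bellOp n c).mulVec (fun x => φ (fun j => x (.inr (.inr j))) *
      (basisKet θ k (fun i => x (.inl i)) * basisKet θ k fun i => x (.inr (.inl i)))) =
    fun x => φ (fun j => x (.inr (.inr j))) *
      ∏ i, bellAmp (θ i) (k i) (x (.inl i)) (x (.inr (.inl i))) := by
  have h := bellGates_mulVec_prod (c := c) (List.finRange n) (List.nodup_finRange n)
    (fun i b => (if θ i then hadamardGate else 1) b.1 (k i) *
      (if θ i then hadamardGate else 1) b.2 (k i)) φ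
  simp only [List.mem_finRange, if_true, Matrix.mulVec, dotProduct, bellGate_basis,
    Finset.prod_mul_distrib] at h
  exact h

/-! ### The winning operator -/

/-- The operator whose expectation is the winning probability for given `(p, θ)`. -/
noncomputable def winOp (θ : Bits n) (Q : POVM (Bits n) (Fin c)) :
    Op (Fin n ⊕ Fin n ⊕ Fin c) :=
  ∑ k, tensor (ketbra (basisKet θ k)) (tensor (ketbra (basisKet θ k)) (Q.op k))

/-- The entries of the winning operator after the Bell measurement: each outcome `k` contributes the
product of a rank one operator on `A`, `B` and the POVM element on `C`. -/
theorem bellOp_conj_winOp (θ : Bits n) (Q : POVM (Bits n) (Fin c))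
    (x y : Fin n ⊕ Fin n ⊕ Fin c → Bool) :
    (bellOp n c * winOp θ Q * (bellOp n c).conjTranspose) x y =
      ∑ k, (∏ i, bellAmp (θ i) (k i) (x (.inl i)) (x (.inr (.inl i)))) *
        star (∏ i, bellAmp (θ i) (k i) (y (.inl i)) (y (.inr (.inl i)))) *
        Q.op k (fun j => x (.inr (.inr j))) (fun j => y (.inr (.inr j))) := by
  rw [winOp, Matrix.mul_sum, Matrix.sum_mul, Matrix.sum_apply]
  refine Finset.sum_congr rfl fun k _ => ?_
  set v := basisKet θ k with hv
  have h1 : ∀ z, (bellOp n c * tensor (ketbra v) (tensor (ketbra v) (Q.op k))) x z =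
      (∏ i, bellAmp (θ i) (k i) (x (.inl i)) (x (.inr (.inl i)))) *
        (star (v (fun i => z (.inl i)) * v fun i => z (.inr (.inl i))) *
        Q.op k (fun j => x (.inr (.inr j))) (fun j => z (.inr (.inr j)))) := by
    intro z
    have h := congrFun (bellOp_mulVec_basis θ k fun xc =>
      star (v (fun i => z (.inl i)) * v fun i => z (.inr (.inl i))) *
        Q.op k xc (fun j => z (.inr (.inr j)))) x
    refine Eq.trans ?_ (h.trans (mul_comm _ _))
    rw [Matrix.mul_apply, Matrix.mulVec, dotProduct]
    refine Finset.sum_congr rfl fun x' _ => ?_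
    simp only [tensor, ketbra, Matrix.of_apply, Matrix.vecMulVec_apply, Pi.star_apply, star_mul']
    rw [← hv]
    ring
  have h2 := congrFun (bellOp_mulVec_basis θ k fun zc =>
    star (Q.op k (fun j => x (.inr (.inr j))) zc)) y
  rw [Matrix.mul_apply]
  simp only [h1, Matrix.conjTranspose_apply]
  rw [Matrix.mulVec, dotProduct] at h2
  have h3 := congrArg star h2
  simp only [star_sum, star_mul', star_star] at h3
  rw [mul_assoc, mul_comm (star (∏ i, _)) (Q.op k _ _), ← h3, Finset.mul_sum]
  refine Finset.sum_congr rfl fun z _ => ?_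
  rw [star_mul', ← hv]
  ring

theorem tensor_eq_submatrix {V W : Type} (M : Op V) (N : Op W) :
    tensor M N = (M ⊗ₖ N).submatrix (Equiv.sumArrowEquivProdArrow V W Bool)
      (Equiv.sumArrowEquivProdArrow V W Bool) := rfl

theorem posSemidef_tensor {V W : Type} [Fintype V] [Fintype W] [DecidableEq V] [DecidableEq W]
    {M : Op V} {N : Op W} (hM : M.PosSemidef) (hN : N.PosSemidef) :
    (tensor M N).PosSemidef := by
  rw [tensor_eq_submatrix]
  exact (hM.kronecker hN).submatrix _

theorem tensor_one_one {V W : Type} [Fintype V] [Fintype W] [DecidableEq V] [DecidableEq W] :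
    tensor (1 : Op V) (1 : Op W) = 1 := by
  rw [tensor_eq_submatrix, Matrix.one_kronecker_one, Matrix.submatrix_one_equiv]

theorem tensor_sum {V W K : Type} (M : Op V) (s : Finset K) (N : K → Op W) :
    tensor M (∑ k ∈ s, N k) = ∑ k ∈ s, tensor M (N k) := by
  ext x y
  simp [tensor, Matrix.sum_apply, Finset.mul_sum]

theorem star_dotProduct_basisKet {W : Type} [Fintype W] [DecidableEq W] (θ x : W → Bool) :
    star (basisKet θ x) ⬝ᵥ basisKet θ x = 1 := by
  have h2 := sqrt_two_mul_self
  have h0 : (Real.sqrt 2 : ℂ) ≠ 0 := fun h => by simp [h] at h2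
  have h : ∀ t k : Bool, (∑ b : Bool, star ((if t then hadamardGate else 1) b k) *
      (if t then hadamardGate else 1) b k) = 1 := by
    intro t k
    cases t <;> cases k <;> simp [hadamardGate] <;> field_simp <;>
      first | ring1 | linear_combination h2 | linear_combination -h2
  simp only [dotProduct, basisKet, Pi.star_apply, star_prod, ← Finset.prod_mul_distrib]
  rw [← Fintype.piFinset_univ, ← Finset.prod_univ_sum (fun _ => Finset.univ)
    (fun i b => star ((if θ i then hadamardGate else 1) b (x i)) *
      (if θ i then hadamardGate else 1) b (x i))]
  simp only [h, Finset.prod_const_one]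

theorem ketbra_basisKet_le_one {W : Type} [Fintype W] [DecidableEq W] (θ x : W → Bool) :
    ketbra (basisKet θ x) ≤ 1 := by
  have h := vecMulVec_le (basisKet θ x)
  rwa [star_dotProduct_basisKet, one_smul] at h

theorem posSemidef_ketbra {W : Type} [Fintype W] [DecidableEq W] (v : (W → Bool) → ℂ) :
    (ketbra v).PosSemidef :=
  Matrix.posSemidef_vecMulVec_self_star v

theorem posSemidef_winOp (θ : Bits n) (Q : POVM (Bits n) (Fin c)) : (winOp θ Q).PosSemidef :=
  Matrix.posSemidef_sum _ fun k _ => posSemidef_tensor (posSemidef_ketbra _)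
    (posSemidef_tensor (posSemidef_ketbra _) (Q.posSemidef k))

theorem winOp_le_one (θ : Bits n) (Q : POVM (Bits n) (Fin c)) : winOp θ Q ≤ 1 := by
  have h1 : (1 : Op (Fin n ⊕ Fin n ⊕ Fin c)) = ∑ k, tensor 1 (tensor 1 (Q.op k)) := by
    rw [← tensor_sum, ← tensor_sum, Q.sum_eq_one, tensor_one_one, tensor_one_one]
  rw [h1, winOp]
  refine Finset.sum_le_sum fun k _ => ?_
  set K := ketbra (basisKet θ k)
  have hK : (1 - K).PosSemidef := Matrix.le_iff.mp (ketbra_basisKet_le_one θ k)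
  have hsub : tensor 1 (tensor 1 (Q.op k)) - tensor K (tensor K (Q.op k)) =
      tensor (1 - K) (tensor 1 (Q.op k)) + tensor K (tensor (1 - K) (Q.op k)) := by
    ext x y
    simp only [tensor, Matrix.sub_apply, Matrix.add_apply, Matrix.of_apply]
    ring
  rw [Matrix.le_iff, hsub]
  exact (posSemidef_tensor hK (posSemidef_tensor .one (Q.posSemidef k))).add
    (posSemidef_tensor (posSemidef_ketbra _) (posSemidef_tensor hK (Q.posSemidef k)))

end WinningOperator

/-! ### Bounding the winning operator by the acceptance test -/

section Bound

variable {n c : ℕ}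

/-- A weighted Cauchy-Schwarz inequality for the two blocks of a positive semidefinite matrix. -/
theorem add_mul_mul_add_le {m : Type} [Fintype m] {M P Q : Matrix m m ℂ}
    (hM : M.PosSemidef) (hP : P.IsHermitian) (hQ : Q.IsHermitian) {t : ℝ} (ht : 0 < t) :
    (P + Q) * M * (P + Q) ≤ (1 + (t : ℂ) ^ 2) • (P * M * P) +
      (1 + ((t : ℂ) ^ 2)⁻¹) • (Q * M * Q) := by
  have ht' : (t : ℂ) ≠ 0 := Complex.ofReal_ne_zero.mpr ht.ne'
  have h := hM.mul_mul_conjTranspose_same ((t : ℂ) • P - (t : ℂ)⁻¹ • Q)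
  have hadj : ((t : ℂ) • P - (t : ℂ)⁻¹ • Q).conjTranspose = (t : ℂ) • P - (t : ℂ)⁻¹ • Q := by
    rw [Matrix.conjTranspose_sub, Matrix.conjTranspose_smul, Matrix.conjTranspose_smul, hP.eq,
      hQ.eq]
    simp
  rw [hadj] at h
  have heq : (1 + (t : ℂ) ^ 2) • (P * M * P) + (1 + ((t : ℂ) ^ 2)⁻¹) • (Q * M * Q) -
      (P + Q) * M * (P + Q) =
      ((t : ℂ) • P - (t : ℂ)⁻¹ • Q) * M * ((t : ℂ) • P - (t : ℂ)⁻¹ • Q) := by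
    simp only [Matrix.sub_mul, Matrix.mul_sub, Matrix.add_mul, Matrix.mul_add,
      Matrix.smul_mul, Matrix.mul_smul, smul_sub, smul_smul]
    match_scalars <;> field_simp <;> ring
  rw [Matrix.le_iff, heq]
  exact h

open Classical in
/-- The projector onto the bit strings with property `P`. -/
noncomputable def proj {m : Type} [DecidableEq m] (P : m → Prop) : Matrix m m ℂ :=
  Matrix.diagonal fun x => if P x then 1 else 0

open Classical in
theorem proj_mul_mul_proj_apply {m : Type} [Fintype m] [DecidableEq m] (P : m → Prop)
    (M : Matrix m m ℂ) (x y : m) :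
    (proj P * M * proj P) x y = if P x ∧ P y then M x y else 0 := by
  rw [proj, Matrix.mul_diagonal, Matrix.diagonal_mul]
  split_ifs <;> simp_all

theorem isHermitian_proj {m : Type} [DecidableEq m] (P : m → Prop) : (proj P).IsHermitian := by
  classical
  refine Matrix.isHermitian_diagonal_of_self_adjoint _ (funext fun x => ?_)
  simp only [Pi.star_apply]
  split_ifs <;> simp

theorem proj_mul_proj {m : Type} [Fintype m] [DecidableEq m] (P : m → Prop) :
    proj P * proj P = proj P := by
  classical
  rw [proj, Matrix.diagonal_mul_diagonal]
  congr 1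
  funext x
  split_ifs <;> simp

/-- The number of error patterns which are error-free on some residue class modulo `r`. -/
noncomputable def freeCount (n r : ℕ) : ℕ :=
  Nat.card {u : Bits n // ¬ ∀ j < r, ∃ i : Fin n, i.1 % r = j ∧ u i = true}

/-- The error pattern and mismatch pattern satisfy the consistency condition for `θ`, but not the
acceptance test. -/
def LowErr (r : ℕ) (θ u w : Bits n) : Prop :=
  (∀ i, w i = (θ i && u i)) ∧ ¬ ∀ j < r, ∃ i : Fin n, i.1 % r = j ∧ u i = true

open Classical in
theorem sum_normSq_lowErr (r : ℕ) (θ k : Bits n) (a : Bits n × Bits n → ℂ)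
    (ha : a = fun z => if LowErr r θ z.1 z.2 then
      ∏ i, bellAmp (θ i) (k i) (z.1 i) (z.2 i) else 0) :
    star a ⬝ᵥ a = (freeCount n r : ℂ) / 2 ^ n := by
  have h1 : ∀ u w : Bits n, star (a (u, w)) * a (u, w) =
      if w = (fun i => θ i && u i) then
        (if ¬ ∀ j < r, ∃ i : Fin n, i.1 % r = j ∧ u i = true then (1 / 2 : ℂ) ^ n else 0)
      else 0 := by
    intro u w
    subst ha
    by_cases hw : w = fun i => θ i && u i
    · by_cases hu : ¬ ∀ j < r, ∃ i : Fin n, i.1 % r = j ∧ u i = true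
      · have hlow : LowErr r θ u w := ⟨fun i => congrFun hw i, hu⟩
        simp only [if_pos hlow]
        rw [if_pos hw, if_pos hu, star_prod, ← Finset.prod_mul_distrib]
        simp only [normSq_bellAmp, hw, if_true]
        simp
      · have hlow : ¬ LowErr r θ u w := fun h => hu h.2
        simp only [if_neg hlow]
        rw [if_pos hw, if_neg hu, mul_zero]
    · have hlow : ¬ LowErr r θ u w := fun h => hw (funext h.1)
      simp only [if_neg hlow]
      rw [if_neg hw, mul_zero]
  rw [dotProduct, Fintype.sum_prod_type]
  simp only [Pi.star_apply, h1]
  simp only [Finset.sum_ite_eq', Finset.mem_univ, if_true]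
  rw [← Finset.sum_filter, Finset.sum_const, freeCount, Nat.card_eq_fintype_card,
    Fintype.card_subtype, nsmul_eq_mul, one_div, inv_pow, div_eq_mul_inv]

/-- The bits of a string on the registers `A`, `B`, `C`. -/
def abcEquiv (n c : ℕ) :
    (Fin n ⊕ Fin n ⊕ Fin c → Bool) ≃ (Bits n × Bits n) × Bits c :=
  ((Equiv.sumArrowEquivProdArrow _ _ _).trans
    ((Equiv.refl _).prodCongr (Equiv.sumArrowEquivProdArrow _ _ _))).trans
      (Equiv.prodAssoc _ _ _).symm

/-- After the Bell measurement, the part of the winning operator on the low error patterns is small: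
for each outcome `k` it is `|a⟩⟨a| ⊗ Q k`, where `a` is a superposition of the low patterns, each
with an amplitude of modulus `2 ^ (-n / 2)`, and the `Q k` sum to the identity. -/
theorem lowErr_conj_winOp_le (r : ℕ) (θ : Bits n) (Q : POVM (Bits n) (Fin c)) :
    proj (fun x : Fin n ⊕ Fin n ⊕ Fin c → Bool =>
        LowErr r θ (fun i => x (.inl i)) (fun i => x (.inr (.inl i)))) *
      (bellOp n c * winOp θ Q * (bellOp n c).conjTranspose) *
      proj (fun x => LowErr r θ (fun i => x (.inl i)) (fun i => x (.inr (.inl i)))) ≤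
    ((freeCount n r : ℂ) / 2 ^ n) • 1 := by
  classical
  let a : Bits n → Bits n × Bits n → ℂ := fun k z => if LowErr r θ z.1 z.2 then
      ∏ i, bellAmp (θ i) (k i) (z.1 i) (z.2 i) else 0
  have h1 : proj (fun x : Fin n ⊕ Fin n ⊕ Fin c → Bool =>
        LowErr r θ (fun i => x (.inl i)) (fun i => x (.inr (.inl i)))) *
      (bellOp n c * winOp θ Q * (bellOp n c).conjTranspose) *
      proj (fun x => LowErr r θ (fun i => x (.inl i)) (fun i => x (.inr (.inl i)))) =
      ∑ k, (Matrix.vecMulVec (a k) (star (a k)) ⊗ₖ Q.op k).submatrix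
        (abcEquiv n c) (abcEquiv n c) := by
    ext x y
    rw [proj_mul_mul_proj_apply, bellOp_conj_winOp, Matrix.sum_apply]
    have hz : ∀ (k : Bits n), (Matrix.vecMulVec (a k) (star (a k)) ⊗ₖ Q.op k).submatrix
        (abcEquiv n c) (abcEquiv n c) x y =
        a k (fun i => x (.inl i), fun i => x (.inr (.inl i))) *
          star (a k (fun i => y (.inl i), fun i => y (.inr (.inl i)))) *
          Q.op k (fun j => x (.inr (.inr j))) (fun j => y (.inr (.inr j))) := fun k => rfl
    simp only [hz, a]
    by_cases hx : LowErr r θ (fun i => x (.inl i)) (fun i => x (.inr (.inl i)))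
    · by_cases hy : LowErr r θ (fun i => y (.inl i)) (fun i => y (.inr (.inl i)))
      · simp only [hx, hy, and_self, if_true]
      · simp [hy]
    · simp [hx]
  have h2 : (1 : Op (Fin n ⊕ Fin n ⊕ Fin c)) =
      ∑ k, ((1 : Matrix (Bits n × Bits n) (Bits n × Bits n) ℂ) ⊗ₖ Q.op k).submatrix
        (abcEquiv n c) (abcEquiv n c) := by
    have h3 : ∑ k, ((1 : Matrix (Bits n × Bits n) (Bits n × Bits n) ℂ) ⊗ₖ Q.op k).submatrix
        (abcEquiv n c) (abcEquiv n c) =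
        ((1 : Matrix (Bits n × Bits n) (Bits n × Bits n) ℂ) ⊗ₖ ∑ k, Q.op k).submatrix
        (abcEquiv n c) (abcEquiv n c) := by
      ext x y
      simp [Matrix.sum_apply, Finset.mul_sum]
    rw [h3, Q.sum_eq_one, Matrix.one_kronecker_one, Matrix.submatrix_one_equiv]
  rw [h1, h2, Finset.smul_sum]
  refine Finset.sum_le_sum fun k _ => ?_
  have h4 := Matrix.le_iff.mp (vecMulVec_le (a k))
  rw [sum_normSq_lowErr r θ k (a k) rfl] at h4
  have h5 := (h4.kronecker (Q.posSemidef k)).submatrix (abcEquiv n c)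
  rw [Matrix.le_iff]
  convert h5 using 1
  ext x y
  simp only [Matrix.sub_apply, Matrix.smul_apply, Matrix.submatrix_apply, Matrix.kroneckerMap_apply,
    smul_eq_mul]
  ring

/-- The POVM element of the acceptance test preceded by the Bell measurement. -/
noncomputable def acceptOp (r : ℕ) (θ : Bits n) : Op (Fin n ⊕ Fin n ⊕ Fin c) :=
  (bellOp n c).conjTranspose *
    proj (fun x => Accepts r θ (fun i => x (.inl i)) (fun i => x (.inr (.inl i)))) * bellOp n c

/-- The winning operator is bounded by the acceptance test, up to a small multiple of the
identity. -/
theorem winOp_le (r : ℕ) (θ : Bits n) (Q : POVM (Bits n) (Fin c)) {t : ℝ} (ht : 0 < t) :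
    winOp θ Q ≤ (1 + (t : ℂ) ^ 2) • acceptOp r θ +
      ((1 + ((t : ℂ) ^ 2)⁻¹) * ((freeCount n r : ℂ) / 2 ^ n)) • 1 := by
  classical
  set R := bellOp n c with hR
  have hRR : R.conjTranspose * R = 1 := gatesOp_conjTranspose_mul _
  have hRR' : R * R.conjTranspose = 1 := gatesOp_mul_conjTranspose _
  set W := R * winOp θ Q * R.conjTranspose with hW
  have hWpos : W.PosSemidef := (posSemidef_winOp θ Q).mul_mul_conjTranspose_same R
  have hW1 : W ≤ 1 := by
    have h := (Matrix.le_iff.mp (winOp_le_one θ Q)).mul_mul_conjTranspose_same R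
    rw [Matrix.mul_sub, Matrix.sub_mul, Matrix.mul_one, hRR'] at h
    exact Matrix.le_iff.mpr h
  set A := proj (fun x : Fin n ⊕ Fin n ⊕ Fin c → Bool =>
    Accepts r θ (fun i => x (.inl i)) (fun i => x (.inr (.inl i)))) with hA
  set L := proj (fun x : Fin n ⊕ Fin n ⊕ Fin c → Bool =>
    LowErr r θ (fun i => x (.inl i)) (fun i => x (.inr (.inl i)))) with hL
  have hAL : A + L = proj (fun x : Fin n ⊕ Fin n ⊕ Fin c → Bool =>
      ∀ i, x (.inr (.inl i)) = (θ i && x (.inl i))) := by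
    rw [hA, hL, proj, proj, proj, Matrix.diagonal_add]
    congr 1
    funext x
    by_cases hp : ∀ i, x (.inr (.inl i)) = (θ i && x (.inl i))
    · by_cases hq : ∀ j < r, ∃ i : Fin n, i.1 % r = j ∧ x (.inl i) = true
      · rw [if_pos ⟨hp, hq⟩, if_neg fun h => h.2 hq, if_pos hp, add_zero]
      · rw [if_neg fun h => hq h.2, if_pos ⟨hp, hq⟩, if_pos hp, zero_add]
    · rw [if_neg fun h => hp h.1, if_neg fun h => hp h.1, if_neg hp, add_zero]
  -- the winning operator lives on the consistent patterns
  have hsupp : (A + L) * W * (A + L) = W := by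
    ext x y
    rw [hAL, proj_mul_mul_proj_apply]
    have hzero : ∀ z : Fin n ⊕ Fin n ⊕ Fin c → Bool,
        (¬ ∀ i, z (.inr (.inl i)) = (θ i && z (.inl i))) → ∀ k : Bits n,
        (∏ i, bellAmp (θ i) (k i) (z (.inl i)) (z (.inr (.inl i)))) = 0 := by
      intro z hz k
      obtain ⟨i, hi⟩ := not_forall.mp hz
      exact Finset.prod_eq_zero (Finset.mem_univ i) (if_neg hi)
    split_ifs with h
    · rfl
    · rw [hW, hR, bellOp_conj_winOp]
      symm
      refine Finset.sum_eq_zero fun k _ => ?_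
      rcases not_and_or.mp h with h | h
      · rw [hzero x h]
        simp
      · rw [hzero y h]
        simp
  have hAWA : A * W * A ≤ A := by
    have h := (Matrix.le_iff.mp hW1).mul_mul_conjTranspose_same A
    rw [(isHermitian_proj _).eq, Matrix.mul_sub, Matrix.sub_mul, Matrix.mul_one,
      proj_mul_proj] at h
    exact Matrix.le_iff.mpr h
  have hs1 : (0 : ℂ) ≤ 1 + (t : ℂ) ^ 2 := by
    have : (0 : ℝ) ≤ 1 + t ^ 2 := by positivity
    exact_mod_cast this
  have hs2 : (0 : ℂ) ≤ 1 + ((t : ℂ) ^ 2)⁻¹ := by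
    have : (0 : ℝ) ≤ 1 + (t ^ 2)⁻¹ := by positivity
    exact_mod_cast this
  have hmain : W ≤ (1 + (t : ℂ) ^ 2) • A +
      ((1 + ((t : ℂ) ^ 2)⁻¹) * ((freeCount n r : ℂ) / 2 ^ n)) • 1 := by
    have h1 := add_mul_mul_add_le hWpos (isHermitian_proj _ : A.IsHermitian)
      (isHermitian_proj _ : L.IsHermitian) ht
    rw [hsupp] at h1
    refine h1.trans (add_le_add (smul_le_smul_of_nonneg_left hAWA hs1) ?_)
    rw [← smul_smul]
    exact smul_le_smul_of_nonneg_left (lowErr_conj_winOp_le r θ Q) hs2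
  have h := (Matrix.le_iff.mp hmain).conjTranspose_mul_mul_same R
  rw [Matrix.mul_sub, Matrix.sub_mul, Matrix.mul_add, Matrix.add_mul] at h
  rw [Matrix.le_iff]
  convert h using 2
  · simp only [acceptOp, mul_smul_comm, smul_mul_assoc, Matrix.mul_one, hRR, ← hR, ← hA]
  · rw [hW]
    calc winOp θ Q = (R.conjTranspose * R) * winOp θ Q * (R.conjTranspose * R) := by
          rw [hRR, Matrix.one_mul, Matrix.mul_one]
      _ = _ := by simp only [Matrix.mul_assoc]

end Bound

/-! ### Counting error patterns and basis choices -/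

theorem freeCount_le {n r : ℕ} (hr : 0 < r) : freeCount n r * 2 ^ (n / r) ≤ r * 2 ^ n := by
  classical
  -- a pattern that vanishes on the class of `j` can be changed arbitrarily at `n / r` positions
  have hblock : ∀ j < r, Fintype.card {u : Bits n // ∀ i : Fin n, i.1 % r = j → u i = false} *
      2 ^ (n / r) ≤ 2 ^ n := by
    intro j hj
    have hpos : ∀ l : Fin (n / r), l.1 * r + j < n := by
      intro l
      have h1 : (l.1 + 1) * r ≤ n := (Nat.mul_le_mul_right r l.2).trans (Nat.div_mul_le_self n r)
      rw [Nat.add_mul] at h1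
      omega
    let F : {u : Bits n // ∀ i : Fin n, i.1 % r = j → u i = false} × (Fin (n / r) → Bool) →
        Bits n := fun uv i =>
      if i.1 % r = j then (if h : i.1 / r < n / r then uv.2 ⟨i.1 / r, h⟩ else false) else uv.1.1 i
    have hF : Function.Injective F := by
      rintro ⟨⟨u, hu⟩, v⟩ ⟨⟨u', hu'⟩, v'⟩ h
      have hu_eq : u = u' := by
        funext i
        by_cases hi : i.1 % r = j
        · rw [hu i hi, hu' i hi]
        · simpa [F, hi] using congrFun h i
      have hv_eq : v = v' := by
        funext l
        have h1 : (l.1 * r + j) % r = j := by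
          rw [Nat.mul_add_mod_self_right, Nat.mod_eq_of_lt hj]
        have h2 : (l.1 * r + j) / r = l.1 := by
          rw [Nat.mul_comm, Nat.mul_add_div hr, Nat.div_eq_of_lt hj, add_zero]
        simpa [F, h1, h2] using congrFun h ⟨l.1 * r + j, hpos l⟩
      subst hu_eq hv_eq
      rfl
    simpa using Fintype.card_le_of_injective F hF
  have hunion : freeCount n r ≤
      ∑ j : Fin r, Fintype.card {u : Bits n // ∀ i : Fin n, i.1 % r = j → u i = false} := by
    rw [freeCount, Nat.card_eq_fintype_card, ← Fintype.card_sigma]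
    have hex : ∀ u : {u : Bits n // ¬ ∀ j < r, ∃ i : Fin n, i.1 % r = j ∧ u i = true},
        ∃ j : Fin r, ∀ i : Fin n, i.1 % r = j → u.1 i = false := by
      rintro ⟨u, hu⟩
      push Not at hu
      obtain ⟨j, hj, h⟩ := hu
      exact ⟨⟨j, hj⟩, fun i hi => by simpa using h i hi⟩
    choose j hj using hex
    refine Fintype.card_le_of_injective (fun u => ⟨j u, ⟨u.1, hj u⟩⟩ : _ → Σ j : Fin r,
      {u : Bits n // ∀ i : Fin n, i.1 % r = j → u i = false}) fun u u' h => Subtype.ext ?_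
    have := congrArg (fun z : Σ j : Fin r,
      {u : Bits n // ∀ i : Fin n, i.1 % r = j → u i = false} => z.2.1) h
    exact this
  calc freeCount n r * 2 ^ (n / r)
      ≤ (∑ j : Fin r, Fintype.card {u : Bits n // ∀ i : Fin n, i.1 % r = j → u i = false}) *
        2 ^ (n / r) := Nat.mul_le_mul_right _ hunion
    _ = ∑ j : Fin r, Fintype.card {u : Bits n // ∀ i : Fin n, i.1 % r = j → u i = false} *
        2 ^ (n / r) := Finset.sum_mul _ _ _
    _ ≤ ∑ _j : Fin r, 2 ^ n := Finset.sum_le_sum fun j _ => hblock j j.2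
    _ = r * 2 ^ n := by simp

/-- Given the outcome of the Bell measurement, at least `r` bits of an accepted basis choice are
determined. -/
theorem card_accepts_le {n r : ℕ} (hr : 0 < r) (u w : Bits n) :
    Nat.card {θ : Bits n // Accepts r θ u w} * 2 ^ r ≤ 2 ^ n := by
  classical
  by_cases hu : ∀ j < r, ∃ i : Fin n, i.1 % r = j ∧ u i = true
  · choose g hg using fun j : Fin r => hu j.1 j.2
    let m : Fin n → Fin r := fun i => ⟨i.1 % r, Nat.mod_lt _ hr⟩
    have hm : ∀ j, m (g j) = j := fun j => Fin.ext (hg j).1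
    let F : {θ : Bits n // Accepts r θ u w} × (Fin r → Bool) → Bits n := fun θv i =>
      if i = g (m i) then θv.2 (m i) else θv.1.1 i
    have hF : Function.Injective F := by
      rintro ⟨⟨θ, hθ⟩, v⟩ ⟨⟨θ', hθ'⟩, v'⟩ h
      have hθ_eq : θ = θ' := by
        funext i
        by_cases hi : i = g (m i)
        · have hui : u i = true := hi ▸ (hg (m i)).2
          have h1 := hθ.1 i
          have h2 := hθ'.1 i
          rw [hui, Bool.and_true] at h1 h2
          rw [← h1, ← h2]
        · simpa [F, hi] using congrFun h i
      have hv_eq : v = v' := by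
        funext j
        simpa [F, hm] using congrFun h (g j)
      subst hθ_eq hv_eq
      rfl
    simpa using Fintype.card_le_of_injective F hF
  · have : IsEmpty {θ : Bits n // Accepts r θ u w} := ⟨fun θ => hu θ.2.2⟩
    simp

/-! ### The distinguisher -/

theorem ketbra_ket_apply {W : Type} [Fintype W] [DecidableEq W] (z x y : W → Bool) :
    ketbra (ket z) x y = if x = z ∧ y = z then 1 else 0 := by
  simp only [ketbra, ket, Matrix.vecMulVec_apply, Pi.star_apply, Pi.single_apply]
  split_ifs <;> simp_all

theorem reduce_unit_apply {W : Type} [Fintype W] [DecidableEq W] (out : Unit ↪ W) (ρ : Op W) :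
    reduce out ρ (fun _ => true) (fun _ => true) =
      ∑ x, if x (out ()) = true then ρ x x else 0 := by
  simp only [reduce, Matrix.of_apply]
  refine Finset.sum_congr rfl fun x _ => ?_
  rw [Finset.sum_eq_single x]
  · exact if_congr ⟨fun h => h.1 (), fun h => ⟨fun _ => h, fun _ => h, fun _ _ => rfl⟩⟩ rfl rfl
  · intro y _ hy
    refine if_neg fun h => hy (funext fun w => ?_)
    by_cases hw : ∀ o, out o ≠ w
    · exact (h.2.2 w hw).symm
    · push Not at hw
      obtain ⟨o, rfl⟩ := hw
      rw [h.1, h.2.1]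
  · simp

/-- The initial state of the wires of a circuit. -/
noncomputable def Circuit.initial {I O : Type} [Fintype I] [DecidableEq I] (C : Circuit I O)
    (ρ : Op I) : Op (I ⊕ Fin C.adv ⊕ Fin C.anc) :=
  tensor ρ (tensor C.advice (ketbra (ket fun _ => false)))

theorem Circuit.posSemidef_initial {I O : Type} [Fintype I] [DecidableEq I] (C : Circuit I O)
    {ρ : Op I} (hρ : ρ.PosSemidef) : (C.initial ρ).PosSemidef :=
  posSemidef_tensor hρ (posSemidef_tensor C.advice_density.1 (posSemidef_ketbra _))

theorem trace_tensor {V W : Type} [Fintype V] [Fintype W] [DecidableEq V] [DecidableEq W]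
    (M : Op V) (N : Op W) : (tensor M N).trace = M.trace * N.trace := by
  rw [tensor_eq_submatrix, ← Matrix.trace_kronecker]
  exact (Equiv.sumArrowEquivProdArrow V W Bool).sum_comp fun x => (M ⊗ₖ N) x x

theorem trace_ketbra_ket {W : Type} [Fintype W] [DecidableEq W] (z : W → Bool) :
    (ketbra (ket z)).trace = 1 := by
  simp [Matrix.trace, ketbra_ket_apply]

theorem Circuit.trace_initial {I O : Type} [Fintype I] [DecidableEq I] (C : Circuit I O)
    (z : I → Bool) : (C.initial (ketbra (ket z))).trace = 1 := by
  rw [Circuit.initial, trace_tensor, trace_tensor, trace_ketbra_ket, trace_ketbra_ket,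
    C.advice_density.2, one_mul, one_mul]

/-- The state of all wires of a circuit after its gates. -/
noncomputable def Circuit.final {I O : Type} [Fintype I] [DecidableEq I] (C : Circuit I O)
    (ρ : Op I) : Op (I ⊕ Fin C.adv ⊕ Fin C.anc) :=
  gatesOp C.gates * C.initial ρ * (gatesOp C.gates).conjTranspose

theorem Circuit.run_eq {I O : Type} [Fintype I] [DecidableEq I] [Fintype O] (C : Circuit I O)
    (ρ : Op I) : C.run ρ = reduce C.out (C.final ρ) := rfl

theorem Circuit.posSemidef_final {I O : Type} [Fintype I] [DecidableEq I] (C : Circuit I O)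
    {ρ : Op I} (hρ : ρ.PosSemidef) : (C.final ρ).PosSemidef :=
  (C.posSemidef_initial hρ).mul_mul_conjTranspose_same _

theorem Circuit.trace_final {I O : Type} [Fintype I] [DecidableEq I] (C : Circuit I O)
    (z : I → Bool) : (C.final (ketbra (ket z))).trace = 1 := by
  rw [Circuit.final, Matrix.trace_mul_comm, ← Matrix.mul_assoc, gatesOp_conjTranspose_mul,
    Matrix.one_mul, C.trace_initial]

/-- Expectations in the output state of a circuit are monotone in the observable. -/
theorem Circuit.trace_mul_run_mono {I O : Type} [Fintype I] [DecidableEq I] [Fintype O]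
    [DecidableEq O] (C : Circuit I O) (z : I → Bool) {M N : Op O} (h : M ≤ N) :
    (M * C.run (ketbra (ket z))).trace.re ≤ (N * C.run (ketbra (ket z))).trace.re := by
  rw [C.run_eq, trace_mul_reduce, trace_mul_reduce]
  refine trace_mul_mono ?_ (C.posSemidef_final (posSemidef_ketbra _))
  rw [Matrix.le_iff, ← lift_sub]
  exact posSemidef_lift _ (Matrix.le_iff.mp h)

theorem Circuit.trace_run {I O : Type} [Fintype I] [DecidableEq I] [Fintype O]
    [DecidableEq O] (C : Circuit I O) (z : I → Bool) : (C.run (ketbra (ket z))).trace = 1 := by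
  have h := trace_mul_reduce C.out 1 (C.final (ketbra (ket z)))
  rwa [Matrix.one_mul, lift_one, Matrix.one_mul, C.trace_final] at h

/-- The output state of a circuit on a classical input is the average over the inputs. -/
theorem Circuit.run_classicalState {I O : Type} [Fintype I] [DecidableEq I] [Fintype O]
    (C : Circuit I O) (μ : PMF (I → Bool)) (a b : O → Bool) :
    C.run (classicalState μ) a b =
      ∑ z, ((μ z).toReal : ℂ) * C.run (ketbra (ket z)) a b := by
  have h1 : C.initial (classicalState μ) =
      ∑ z, ((μ z).toReal : ℂ) • C.initial (ketbra (ket z)) := by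
    ext x y
    simp only [Circuit.initial, tensor, classicalState, Matrix.sum_apply, Matrix.smul_apply,
      Matrix.of_apply, smul_eq_mul, ketbra_ket_apply, ← mul_assoc, ← Finset.sum_mul]
    congr 1
    rw [Finset.sum_eq_single fun i => x (.inl i)]
    · by_cases h : (fun i => x (.inl i)) = fun i => y (.inl i)
      · rw [h]
        simp
      · rw [Matrix.diagonal_apply_ne _ h]
        simp [Ne.symm h]
    · intro z _ hz
      simp [Ne.symm hz]
    · simp
  have h2 : C.final (classicalState μ) = ∑ z, ((μ z).toReal : ℂ) • C.final (ketbra (ket z)) := by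
    simp only [Circuit.final, h1, Matrix.mul_sum, Matrix.sum_mul, Matrix.mul_smul,
      Matrix.smul_mul]
  simp only [Circuit.run_eq, h2, reduce, Matrix.of_apply, Matrix.sum_apply, Matrix.smul_apply,
    smul_eq_mul, Finset.mul_sum]
  refine Eq.trans (Finset.sum_congr rfl fun x _ => ?_) Finset.sum_comm
  refine Eq.trans (Finset.sum_congr rfl fun y _ => ?_) Finset.sum_comm
  split_ifs
  · rfl
  · simp

section TestCircuit

variable {q n c : ℕ} (C : Circuit (Fin q) (Fin n ⊕ Fin n ⊕ Fin c))

/-- The wires of the distinguisher built from the preparation circuit `C`. -/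
abbrev TestWires (C : Circuit (Fin q) (Fin n ⊕ Fin n ⊕ Fin c)) (r : ℕ) : Type :=
  (Fin q ⊕ Fin n) ⊕ Fin C.adv ⊕ Fin (C.anc + ((n + r) + (n + r + 1)))

/-- The wires of the preparation circuit among those of the distinguisher. -/
def prepWire (r : ℕ) : Fin q ⊕ Fin C.adv ⊕ Fin C.anc ↪ TestWires C r where
  toFun := Sum.elim (fun i => .inl (.inl i))
    (Sum.elim (fun i => .inr (.inl i)) fun i => .inr (.inr (Fin.castAdd _ i)))
  inj' := by
    rintro (i | i | i) (j | j | j) h <;> simp_all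

theorem prepWire_inl (r : ℕ) (i : Fin q) : prepWire C r (.inl i) = .inl (.inl i) := rfl

theorem prepWire_inr_inl (r : ℕ) (i : Fin C.adv) :
    prepWire C r (.inr (.inl i)) = .inr (.inl i) := rfl

theorem prepWire_inr_inr (r : ℕ) (i : Fin C.anc) :
    prepWire C r (.inr (.inr i)) = .inr (.inr (Fin.castAdd _ i)) := rfl

theorem prepWire_ne_basis (r : ℕ) (v : Fin q ⊕ Fin C.adv ⊕ Fin C.anc) (i : Fin n) :
    prepWire C r v ≠ .inl (.inr i) := by
  rcases v with v | v | v <;> simp [prepWire_inl, prepWire_inr_inl, prepWire_inr_inr]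

theorem prepWire_ne_work (r : ℕ) (v : Fin q ⊕ Fin C.adv ⊕ Fin C.anc)
    (j : Fin ((n + r) + (n + r + 1))) : prepWire C r v ≠ .inr (.inr (Fin.natAdd _ j)) := by
  rcases v with v | v | v
  · simp [prepWire_inl]
  · simp [prepWire_inr_inl]
  · simp only [prepWire_inr_inr, ne_eq, Sum.inr.injEq, Fin.ext_iff, Fin.val_castAdd,
      Fin.val_natAdd]
    omega

/-- The wires of the acceptance test among those of the distinguisher. -/
def testWire (r : ℕ) : Reg n r ↪ TestWires C r where
  toFun := Sum.elim (fun i => prepWire C r (C.out (.inl i)))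
    (Sum.elim (fun i => prepWire C r (C.out (.inr (.inl i))))
      (Sum.elim (fun i => .inl (.inr i))
        (Sum.elim (fun j => .inr (.inr (Fin.natAdd _ (Fin.castAdd _ j))))
          fun j => .inr (.inr (Fin.natAdd _ (Fin.natAdd _ j))))))
  inj' := by
    have h1 := prepWire_ne_basis C r
    have h1' := fun v i => (prepWire_ne_basis C r v i).symm
    have h2 := prepWire_ne_work C r
    have h2' := fun v i => (prepWire_ne_work C r v i).symm
    rintro (i | i | i | i | i) (j | j | j | j | j) h <;>
      simp only [Sum.elim_inl, Sum.elim_inr, EmbeddingLike.apply_eq_iff_eq, Sum.inl.injEq,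
        Sum.inr.injEq, reduceCtorEq, h1, h1', h2, h2'] at h ⊢ <;>
      simp only [Fin.ext_iff, Fin.val_natAdd, Fin.val_castAdd] at h ⊢ <;> omega

/-- The gates of the distinguisher. -/
noncomputable def testGates {r : ℕ} (hr : 0 < r) : List (Gate (TestWires C r)) :=
  (C.gates ++ (bellGates n c).map (Gate.map C.out)).map (Gate.map (prepWire C r)) ++
    ((testProgram n hr).map (Instr.map (testWire C r))).flatMap Instr.gates

/-- The output wire of the distinguisher. -/
def testOut (r : ℕ) : Unit ↪ TestWires C r :=
  ⟨fun _ => testWire C r (Reg.ok (Fin.last _)), fun _ _ _ => rfl⟩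

/-- The distinguisher: it prepares the state of the game from `p`, measures the pairs `(Aᵢ, Bᵢ)`
in the Bell basis and runs the acceptance test with the given `θ`. -/
noncomputable def testCircuit {r : ℕ} (hr : 0 < r) : Circuit (Fin q ⊕ Fin n) Unit where
  adv := C.adv
  anc := C.anc + ((n + r) + (n + r + 1))
  advice := C.advice
  advice_density := C.advice_density
  gates := testGates C hr
  out := testOut C r

theorem size_testCircuit {r : ℕ} (hr : 0 < r) :
    (testCircuit C hr).size ≤ C.size + 19 * n + 7 * r + 1 := by
  have h : (testGates C hr).length = C.gates.length + n + 5 * (3 * n + r) := by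
    rw [testGates, List.length_append, length_flatMap_gates, List.length_map, List.length_map,
      length_testProgram]
    simp [bellGates]
  have h' : (testCircuit C hr).size = (testGates C hr).length + (Fintype.card (Fin q ⊕ Fin n) +
    C.adv + (C.anc + ((n + r) + (n + r + 1)))) := rfl
  rw [h', h, Circuit.size]
  simp only [Fintype.card_sum, Fintype.card_fin]
  omega

/-- The initial state of the wires outside the preparation circuit. -/
def testInit (r : ℕ) (θ : Bits n) : TestWires C r → Bool :=
  Sum.elim (Sum.elim (fun _ => false) θ) fun _ => false

theorem initial_testCircuit (r : ℕ) (p : Bits q) (θ : Bits n) :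
    tensor (ketbra (ket (Sum.elim p θ))) (tensor C.advice (ketbra (ket fun _ => false))) =
      pad (prepWire C r) (testInit C r θ) (C.initial (ketbra (ket p))) := by
  ext x y
  rw [pad_apply]
  simp only [Circuit.initial, tensor, Matrix.of_apply, ketbra_ket_apply]
  have key : ∀ x : TestWires C r → Bool,
      (((fun i => x (.inl i)) = Sum.elim p θ ∧ (fun i => x (.inr (.inr i))) = fun _ => false) ↔
      (∀ w, (∀ v, prepWire C r v ≠ w) → x w = testInit C r θ w) ∧
        ((fun i => x (prepWire C r (.inl i))) = p ∧
          (fun i => x (prepWire C r (.inr (.inr i)))) = fun _ => false)) := by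
    intro x
    constructor
    · rintro ⟨h1, h2⟩
      refine ⟨?_, funext fun i => congrFun h1 (.inl i), funext fun i => congrFun h2 _⟩
      rintro ((w | w) | w | w) hw
      · exact absurd rfl (hw (.inl w))
      · exact congrFun h1 (.inr w)
      · exact absurd rfl (hw (.inr (.inl w)))
      · exact congrFun h2 w
    · rintro ⟨h1, h2, h3⟩
      constructor
      · funext i
        rcases i with i | i
        · exact congrFun h2 i
        · exact h1 _ fun v => prepWire_ne_basis C r v i
      · funext i
        refine Fin.addCases (fun i => congrFun h3 i) (fun i => ?_) i
        exact h1 _ fun v => prepWire_ne_work C r v i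
  have hx := key x
  have hy := key y
  by_cases h : ((fun i => x (.inl i)) = Sum.elim p θ ∧
      (fun i => x (.inr (.inr i))) = fun _ => false) ∧
      ((fun i => y (.inl i)) = Sum.elim p θ ∧ (fun i => y (.inr (.inr i))) = fun _ => false)
  · obtain ⟨hx1, hx2, hx3⟩ := hx.mp h.1
    obtain ⟨hy1, hy2, hy3⟩ := hy.mp h.2
    rw [if_pos ⟨h.1.1, h.2.1⟩, if_pos ⟨h.1.2, h.2.2⟩, if_pos fun w hw => ⟨hx1 w hw, hy1 w hw⟩]
    simp only [Function.comp_apply]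
    rw [if_pos ⟨hx2, hy2⟩, if_pos ⟨hx3, hy3⟩]
    rfl
  · trans 0
    · split_ifs with h1 h2
      · exact absurd ⟨⟨h1.1, h2.1⟩, ⟨h1.2, h2.2⟩⟩ h
      all_goals simp
    · symm
      split_ifs with h1 h2 h3
      · exact absurd ⟨hx.mpr ⟨fun w hw => (h1 w hw).1, h2.1, h3.1⟩,
          hy.mpr ⟨fun w hw => (h1 w hw).2, h2.2, h3.2⟩⟩ h
      all_goals simp

/-- The acceptance probability of the distinguisher on `(p, θ)`. -/
theorem run_testCircuit {r : ℕ} (hr : 0 < r) (hrn : r ≤ n) (p : Bits q) (θ : Bits n) :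
    (testCircuit C hr).run (ketbra (ket (Sum.elim p θ))) (fun _ => true) (fun _ => true) =
      (acceptOp r θ * C.run (ketbra (ket p))).trace := by
  classical
  set σ := C.final (ketbra (ket p)) with hσ
  set B := lift C.out (bellOp n c) with hB
  have h1 : gatesOp (testGates C hr) * tensor (ketbra (ket (Sum.elim p θ)))
        (tensor C.advice (ketbra (ket fun _ => false))) * (gatesOp (testGates C hr)).conjTranspose =
      gatesOp (((testProgram n hr).map (Instr.map (testWire C r))).flatMap Instr.gates) *
        pad (prepWire C r) (testInit C r θ) (B * σ * B.conjTranspose) *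
      (gatesOp (((testProgram n hr).map (Instr.map (testWire C r))).flatMap
        Instr.gates)).conjTranspose := by
    rw [initial_testCircuit]
    have hg : gatesOp (testGates C hr) =
        gatesOp (((testProgram n hr).map (Instr.map (testWire C r))).flatMap Instr.gates) *
          lift (prepWire C r) (B * gatesOp C.gates) := by
      rw [testGates, gatesOp_append, gatesOp_map, gatesOp_append, gatesOp_map]
      rfl
    have hp : B * σ * B.conjTranspose = B * gatesOp C.gates * C.initial (ketbra (ket p)) *
        (B * gatesOp C.gates).conjTranspose := by
      rw [hσ, Circuit.final, Matrix.conjTranspose_mul]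
      simp only [Matrix.mul_assoc]
    rw [hg, hp, ← lift_mul_pad_mul, Matrix.conjTranspose_mul]
    simp only [Matrix.mul_assoc]
  have h2 : ∀ x : Fin q ⊕ Fin C.adv ⊕ Fin C.anc → Bool,
      execute ((testProgram n hr).map (Instr.map (testWire C r)))
        (extend (prepWire C r) (testInit C r θ) x) (testWire C r (Reg.ok (Fin.last _))) = true ↔
      Accepts r θ (fun i => x (C.out (.inl i))) (fun i => x (C.out (.inr (.inl i)))) := by
    intro x
    have hout : ∀ w, (∀ v, prepWire C r v ≠ w) →
        extend (prepWire C r) (testInit C r θ) x w = testInit C r θ w := fun w hw =>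
      extend_apply_of_notMem _ _ _ fun ⟨v, hv⟩ => hw v hv
    rw [execute_map, execute_testProgram hr hrn]
    · have e1 : (fun i => extend (prepWire C r) (testInit C r θ) x
          (testWire C r (Reg.basis i))) = θ := by
        funext i
        exact hout _ fun v => prepWire_ne_basis C r v i
      have e2 : (fun i => extend (prepWire C r) (testInit C r θ) x
          (testWire C r (Reg.err i))) = fun i => x (C.out (.inl i)) :=
        funext fun i => extend_apply _ _ _ _
      have e3 : (fun i => extend (prepWire C r) (testInit C r θ) x
          (testWire C r (Reg.mis i))) = fun i => x (C.out (.inr (.inl i))) :=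
        funext fun i => extend_apply _ _ _ _
      rw [e1, e2, e3]
    · intro j
      exact hout _ fun v => prepWire_ne_work C r v _
    · intro j
      exact hout _ fun v => prepWire_ne_work C r v _
  have h3 : lift C.out (acceptOp r θ) = B.conjTranspose *
      proj (fun x => Accepts r θ (fun i => x (C.out (.inl i)))
        (fun i => x (C.out (.inr (.inl i))))) * B := by
    rw [acceptOp, lift_mul, lift_mul, lift_conjTranspose, ← hB]
    congr 2
    ext x y
    rw [lift_apply, proj, proj, Matrix.diagonal_apply, Matrix.diagonal_apply]
    by_cases hxy : x = y
    · subst hxy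
      simp
    · rw [if_neg hxy]
      split_ifs with h4 h5 h6 <;> try rfl
      refine absurd (funext fun w => ?_) hxy
      by_cases hw : ∀ v, C.out v ≠ w
      · exact h4 w hw
      · push Not at hw
        obtain ⟨v, rfl⟩ := hw
        exact congrFun h5 v
  have h4 : (testCircuit C hr).run (ketbra (ket (Sum.elim p θ))) = reduce (testOut C r)
      (gatesOp (testGates C hr) * tensor (ketbra (ket (Sum.elim p θ)))
        (tensor C.advice (ketbra (ket fun _ => false))) *
        (gatesOp (testGates C hr)).conjTranspose) := rfl
  rw [h4, reduce_unit_apply, h1]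
  refine (sum_program_conj_diag _ _ _).trans ?_
  have h5 : ∀ P : Op (Fin q ⊕ Fin C.adv ⊕ Fin C.anc),
      (B.conjTranspose * P * B * σ).trace = (P * (B * σ * B.conjTranspose)).trace := by
    intro P
    rw [Matrix.mul_assoc, Matrix.mul_assoc, Matrix.trace_mul_comm]
    simp only [Matrix.mul_assoc]
  rw [sum_pad, C.run_eq, trace_mul_reduce, h3, ← hσ, h5, Matrix.trace, proj]
  refine Finset.sum_congr rfl fun x _ => ?_
  rw [Matrix.diag_apply, Matrix.diagonal_mul]
  rw [ite_mul, one_mul, zero_mul]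
  exact if_congr (h2 x) rfl rfl

end TestCircuit

/-! ### The winning probability for fixed security parameter -/

theorem acceptOp_le_one {n c : ℕ} (r : ℕ) (θ : Bits n) :
    (acceptOp r θ : Op (Fin n ⊕ Fin n ⊕ Fin c)) ≤ 1 := by
  classical
  have h : (proj (fun x : Fin n ⊕ Fin n ⊕ Fin c → Bool =>
      Accepts r θ (fun i => x (.inl i)) (fun i => x (.inr (.inl i))))) ≤ 1 := by
    rw [Matrix.le_iff, proj, ← Matrix.diagonal_one, Matrix.diagonal_sub]
    refine Matrix.PosSemidef.diagonal fun x => ?_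
    simp only [Pi.zero_apply]
    split_ifs <;> simp
  have h' := (Matrix.le_iff.mp h).conjTranspose_mul_mul_same (bellOp n c)
  rw [Matrix.mul_sub, Matrix.sub_mul, Matrix.mul_one, bellOp, gatesOp_conjTranspose_mul] at h'
  exact Matrix.le_iff.mpr h'

/-- For a uniformly random basis choice the acceptance probability is at most `2 ^ (-r)`, whatever
the state. -/
theorem sum_acceptOp_le {n c : ℕ} {r : ℕ} (hr : 0 < r) :
    ∑ θ : Bits n, (acceptOp r θ : Op (Fin n ⊕ Fin n ⊕ Fin c)) ≤ ((2 ^ n / 2 ^ r : ℝ) : ℂ) • 1 := by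
  classical
  have h : (∑ θ : Bits n, proj (fun x : Fin n ⊕ Fin n ⊕ Fin c → Bool =>
      Accepts r θ (fun i => x (.inl i)) (fun i => x (.inr (.inl i))))) ≤
      ((2 ^ n / 2 ^ r : ℝ) : ℂ) • 1 := by
    have h1 : (∑ θ : Bits n, proj (fun x : Fin n ⊕ Fin n ⊕ Fin c → Bool =>
        Accepts r θ (fun i => x (.inl i)) (fun i => x (.inr (.inl i))))) =
        Matrix.diagonal fun x : Fin n ⊕ Fin n ⊕ Fin c → Bool =>
          (Nat.card {θ : Bits n // Accepts r θ (fun i => x (.inl i))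
            (fun i => x (.inr (.inl i)))} : ℂ) := by
      ext x y
      rw [Matrix.sum_apply]
      simp only [proj, Matrix.diagonal_apply]
      by_cases hxy : x = y
      · subst hxy
        simp only [if_true]
        rw [Finset.sum_boole, Nat.card_eq_fintype_card, Fintype.card_subtype]
      · simp [hxy]
    rw [h1, Matrix.le_iff, ← Matrix.diagonal_one, ← Matrix.diagonal_smul, Matrix.diagonal_sub]
    refine Matrix.PosSemidef.diagonal fun x => ?_
    simp only [Pi.zero_apply, Pi.smul_apply, smul_eq_mul, mul_one, sub_nonneg]
    have h2 := card_accepts_le hr (fun i => x (.inl i)) (fun i => x (.inr (.inl i)))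
    have h3 : (Nat.card {θ : Bits n // Accepts r θ (fun i => x (.inl i))
        (fun i => x (.inr (.inl i)))} : ℝ) ≤ 2 ^ n / 2 ^ r := by
      rw [le_div_iff₀ (by positivity)]
      exact_mod_cast h2
    have h4 := Complex.real_le_real.mpr h3
    simpa using h4
  have h' := (Matrix.le_iff.mp h).conjTranspose_mul_mul_same (bellOp n c)
  rw [Matrix.mul_sub, Matrix.sub_mul, Matrix.mul_smul, Matrix.smul_mul, Matrix.mul_one, bellOp,
    gatesOp_conjTranspose_mul, Matrix.mul_sum, Matrix.sum_mul] at h'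
  exact Matrix.le_iff.mpr h'

section Game

variable {q n : ℕ → ℕ} (S : Strategy q n) (κ : ℕ)

/-- The probability that the acceptance test with `r` classes accepts the prepared state. -/
noncomputable def Strategy.acceptProb (r : ℕ) (p : Bits (q κ)) (θ : Bits (n κ)) : ℝ :=
  (acceptOp r θ * S.state κ p).trace.re

theorem Strategy.acceptProb_le_one (r : ℕ) (p : Bits (q κ)) (θ : Bits (n κ)) :
    S.acceptProb κ r p θ ≤ 1 := by
  have h := (S.prep.circuit κ).trace_mul_run_mono p (acceptOp_le_one r θ)
  rw [Matrix.one_mul, Circuit.trace_run] at h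
  exact h

theorem Strategy.sum_acceptProb_le {r : ℕ} (hr : 0 < r) (p : Bits (q κ)) :
    ∑ θ, S.acceptProb κ r p θ ≤ 2 ^ n κ / 2 ^ r := by
  have h := (S.prep.circuit κ).trace_mul_run_mono p (sum_acceptOp_le hr)
  rw [Matrix.smul_mul, Matrix.one_mul, Matrix.trace_smul, Circuit.trace_run, smul_eq_mul, mul_one,
    Complex.ofReal_re, Matrix.sum_mul, Matrix.trace_sum, Complex.re_sum] at h
  exact h

theorem Strategy.outcomeProb_nonneg (p : Bits (q κ)) (θ a b k : Bits (n κ)) :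
    0 ≤ S.outcomeProb κ p θ a b k := by
  have hpos := posSemidef_tensor (posSemidef_ketbra (basisKet θ a))
    (posSemidef_tensor (posSemidef_ketbra (basisKet θ b)) ((S.meas κ p θ).posSemidef k))
  have h := (S.prep.circuit κ).trace_mul_run_mono p hpos.nonneg
  rw [Matrix.zero_mul, Matrix.trace_zero] at h
  exact h

theorem Strategy.winProb_nonneg (Z : ∀ κ, PMF (Bits (q κ) × Bits (n κ))) :
    0 ≤ S.winProb Z κ :=
  Finset.sum_nonneg fun _ _ => mul_nonneg ENNReal.toReal_nonneg
    (Finset.sum_nonneg fun _ _ => S.outcomeProb_nonneg κ _ _ _ _ _)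

/-- For given `(p, θ)`, winning is hardly more likely than acceptance. -/
theorem Strategy.sum_outcomeProb_le (r : ℕ) (p : Bits (q κ)) (θ : Bits (n κ)) {t : ℝ}
    (ht : 0 < t) :
    ∑ k, S.outcomeProb κ p θ k k k ≤ S.acceptProb κ r p θ + t ^ 2 +
      (1 + (t ^ 2)⁻¹) * ((freeCount (n κ) r : ℝ) / 2 ^ n κ) := by
  have h := (S.prep.circuit κ).trace_mul_run_mono p (winOp_le r θ (S.meas κ p θ) ht)
  have h1 : (winOp θ (S.meas κ p θ) * (S.prep.circuit κ).run (ketbra (ket p))).trace.re =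
      ∑ k, S.outcomeProb κ p θ k k k := by
    rw [winOp, Matrix.sum_mul, Matrix.trace_sum, Complex.re_sum]
    rfl
  have h2 : ((1 + (t : ℂ) ^ 2) • acceptOp r θ * (S.prep.circuit κ).run (ketbra (ket p))).trace.re =
      (1 + t ^ 2) * S.acceptProb κ r p θ := by
    rw [Matrix.smul_mul, Matrix.trace_smul, smul_eq_mul,
      show (1 + (t : ℂ) ^ 2) = ((1 + t ^ 2 : ℝ) : ℂ) by push_cast; rfl, Complex.re_ofReal_mul]
    rfl
  have h3 : (((1 + ((t : ℂ) ^ 2)⁻¹) * ((freeCount (n κ) r : ℂ) / 2 ^ n κ)) •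
      (1 : Op (Fin (n κ) ⊕ Fin (n κ) ⊕ Fin (S.c κ))) *
        (S.prep.circuit κ).run (ketbra (ket p))).trace.re =
      (1 + (t ^ 2)⁻¹) * ((freeCount (n κ) r : ℝ) / 2 ^ n κ) := by
    rw [Matrix.smul_mul, Matrix.one_mul, Matrix.trace_smul, Circuit.trace_run, smul_eq_mul, mul_one,
      show ((1 + ((t : ℂ) ^ 2)⁻¹) * ((freeCount (n κ) r : ℂ) / 2 ^ n κ)) =
        (((1 + (t ^ 2)⁻¹) * ((freeCount (n κ) r : ℝ) / 2 ^ n κ) : ℝ) : ℂ) by push_cast; rfl,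
      Complex.ofReal_re]
  rw [Matrix.add_mul, Matrix.trace_add, Complex.add_re, h1, h2, h3] at h
  nlinarith [S.acceptProb_le_one κ r p θ, sq_nonneg t]

end Game

theorem sum_toReal_bind {α β : Type} [Fintype α] [Fintype β] (μ : PMF α) (f : α → PMF β)
    (g : β → ℝ) :
    ∑ b, ((μ.bind f) b).toReal * g b = ∑ a, (μ a).toReal * ∑ b, (f a b).toReal * g b := by
  have h : ∀ b, ((μ.bind f) b).toReal = ∑ a, (μ a).toReal * (f a b).toReal := by
    intro b
    rw [PMF.bind_apply, tsum_fintype, ENNReal.toReal_sum fun a _ =>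
      ENNReal.mul_ne_top (μ.apply_ne_top a) ((f a).apply_ne_top b)]
    simp only [ENNReal.toReal_mul]
  simp only [h, Finset.sum_mul, Finset.mul_sum, mul_assoc]
  rw [Finset.sum_comm]

theorem sum_toReal_map {α β : Type} [Fintype α] [Fintype β] (μ : PMF α) (f : α → β)
    (g : β → ℝ) :
    ∑ b, ((μ.map f) b).toReal * g b = ∑ a, (μ a).toReal * g (f a) := by
  classical
  rw [PMF.map, sum_toReal_bind]
  refine Finset.sum_congr rfl fun a _ => ?_
  congr 1
  rw [Finset.sum_eq_single (f a)]
  · simp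
  · intro b _ hb
    simp [PMF.pure_apply, hb]
  · simp

theorem sum_toReal_eq_one {α : Type} [Fintype α] (μ : PMF α) : ∑ a, (μ a).toReal = 1 := by
  rw [← ENNReal.toReal_sum fun a _ => μ.apply_ne_top a, ← tsum_fintype (L := .unconditional _),
    μ.tsum_coe, ENNReal.toReal_one]

theorem sum_toReal_refresh {q n : ℕ} (μ : PMF (Bits q × Bits n)) (g : Bits q × Bits n → ℝ) :
    ∑ b, (refresh μ b).toReal * g b =
      ∑ a, (μ a).toReal * ((2 ^ n)⁻¹ * ∑ θ, g (a.1, θ)) := by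
  rw [refresh, sum_toReal_bind]
  refine Finset.sum_congr rfl fun a _ => ?_
  rw [sum_toReal_map]
  simp [PMF.uniformOfFintype_apply, Finset.mul_sum]

/-- The number of residue classes in the acceptance test for `n` positions: about `√n / 2`, so that
both `2 ^ (-r)` and the square root of `2 ^ (-n / r)` are at most of order `2 ^ (-√n / 2)`. -/
def numClasses (n : ℕ) : ℕ := Nat.sqrt n / 2 + 1

theorem numClasses_pos (n : ℕ) : 0 < numClasses n := Nat.succ_pos _

theorem numClasses_le {n : ℕ} (hn : 0 < n) : numClasses n ≤ n := by
  have h1 := Nat.sqrt_le_self n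
  unfold numClasses
  rcases Nat.lt_or_ge n 2 with h | h
  · obtain rfl : n = 1 := by omega
    simp
  · omega

/-- The distinguisher derived from a strategy. -/
noncomputable def testDistinguisher {q n : ℕ → ℕ} (S : Strategy q n) (hn : PolyBounded n) :
    Distinguisher fun κ => Fin (q κ) ⊕ Fin (n κ) where
  circuit κ := testCircuit (S.prep.circuit κ) (numClasses_pos (n κ))
  poly_size := by
    obtain ⟨P, hP⟩ := S.prep.poly_size
    obtain ⟨N, hN⟩ := hn
    refine ⟨P + 26 * N + 8, fun κ => ?_⟩
    have h1 := size_testCircuit (S.prep.circuit κ) (numClasses_pos (n κ))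
    have h2 : numClasses (n κ) ≤ n κ + 1 := by
      have := Nat.sqrt_le_self (n κ)
      unfold numClasses
      omega
    have h3 : (S.prep.circuit κ).size ≤ P.eval κ := hP κ
    have h4 := hN κ
    simp only [Polynomial.eval_add, Polynomial.eval_mul, Polynomial.eval_ofNat]
    omega

theorem prOne_testDistinguisher {q n : ℕ → ℕ} (S : Strategy q n) (hn : PolyBounded n) (κ : ℕ)
    (hκ : 0 < n κ) (μ : PMF (Bits (q κ) × Bits (n κ))) :
    (testDistinguisher S hn).prOne κ (pairState μ) =
      ∑ pt, (μ pt).toReal * S.acceptProb κ (numClasses (n κ)) pt.1 pt.2 := by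
  have h1 : (testDistinguisher S hn).prOne κ (pairState μ) =
      ∑ z, ((μ.map fun pt => Sum.elim pt.1 pt.2) z).toReal *
        ((testCircuit (S.prep.circuit κ) (numClasses_pos (n κ))).run (ketbra (ket z))
          (fun _ => true) (fun _ => true)).re := by
    rw [Distinguisher.prOne, testDistinguisher, pairState, Circuit.run_classicalState,
      Complex.re_sum]
    simp only [Complex.re_ofReal_mul]
  rw [h1, sum_toReal_map]
  refine Finset.sum_congr rfl fun pt _ => ?_
  rw [run_testCircuit _ _ (numClasses_le hκ)]
  rfl

/-- The winning probability is at most the acceptance probability for uniform bases, plus the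
distinguishing advantage, plus the weight of the low error patterns. -/
theorem Strategy.winProb_le {q n : ℕ → ℕ} (S : Strategy q n) (hn : PolyBounded n)
    (Z : ∀ κ, PMF (Bits (q κ) × Bits (n κ))) (κ : ℕ) (hκ : 0 < n κ) {η t : ℝ} (ht : 0 < t)
    (h : |(testDistinguisher S hn).prOne κ (pairState (Z κ)) -
      (testDistinguisher S hn).prOne κ (pairState (refresh (Z κ)))| ≤ η) :
    S.winProb Z κ ≤ (2 ^ numClasses (n κ))⁻¹ + t ^ 2 +
      (1 + (t ^ 2)⁻¹) * ((freeCount (n κ) (numClasses (n κ)) : ℝ) / 2 ^ n κ) + η := by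
  set r := numClasses (n κ)
  set e := t ^ 2 + (1 + (t ^ 2)⁻¹) * ((freeCount (n κ) r : ℝ) / 2 ^ n κ) with he
  have h1 : S.winProb Z κ ≤ (∑ pt, (Z κ pt).toReal * S.acceptProb κ r pt.1 pt.2) + e := by
    have h2 : ∑ pt, (Z κ pt).toReal * e = e := by
      rw [← Finset.sum_mul, sum_toReal_eq_one, one_mul]
    rw [← h2, ← Finset.sum_add_distrib]
    refine Finset.sum_le_sum fun pt _ => ?_
    rw [← mul_add]
    refine mul_le_mul_of_nonneg_left ?_ ENNReal.toReal_nonneg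
    have := S.sum_outcomeProb_le κ r pt.1 pt.2 ht
    rw [he]
    linarith
  have h2 : ∑ pt, (refresh (Z κ) pt).toReal * S.acceptProb κ r pt.1 pt.2 ≤ (2 ^ r)⁻¹ := by
    rw [sum_toReal_refresh]
    calc _ ≤ ∑ a, (Z κ a).toReal * ((2 : ℝ) ^ r)⁻¹ := by
          refine Finset.sum_le_sum fun a _ => mul_le_mul_of_nonneg_left ?_ ENNReal.toReal_nonneg
          have h3 := S.sum_acceptProb_le κ (numClasses_pos (n κ)) a.1
          calc _ ≤ ((2 : ℝ) ^ n κ)⁻¹ * (2 ^ n κ / 2 ^ r) :=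
                mul_le_mul_of_nonneg_left h3 (by positivity)
            _ = ((2 : ℝ) ^ r)⁻¹ := by field_simp
      _ = ((2 : ℝ) ^ r)⁻¹ := by rw [← Finset.sum_mul, sum_toReal_eq_one, one_mul]
  rw [prOne_testDistinguisher S hn κ hκ, prOne_testDistinguisher S hn κ hκ] at h
  have h3 := (abs_le.mp h).2
  linarith

/-! ### Asymptotics -/

/-- The error terms of `Strategy.winProb_le` for `t ^ 2 = 2 ^ (-√m / 2)`. With `s = √m / 2` they are
at most `2 ^ (-s)`, `2 ^ (-s)` and `2 ^ (s + 1) * (s + 1) * 2 ^ (5 - 4 * s)`. -/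
theorem error_le (m : ℕ) :
    ((2 : ℝ) ^ numClasses m)⁻¹ + (2 : ℝ) ^ (-(1 / 2 : ℝ) * Real.sqrt m) +
      (1 + ((2 : ℝ) ^ (-(1 / 2 : ℝ) * Real.sqrt m))⁻¹) *
        ((freeCount m (numClasses m) : ℝ) / 2 ^ m) ≤
      130 * (2 : ℝ) ^ (-(1 / 2 : ℝ) * Real.sqrt m) := by
  set s : ℝ := 1 / 2 * Real.sqrt m with hs
  have hs0 : 0 ≤ s := by positivity
  have hsm : 4 * s ^ 2 = m := by
    rw [hs, mul_pow, Real.sq_sqrt (Nat.cast_nonneg m)]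
    ring
  have hexp : -(1 / 2 : ℝ) * Real.sqrt m = -s := by rw [hs]; ring
  rw [hexp]
  set x : ℝ := (2 : ℝ) ^ (-s) with hx
  set r := numClasses m with hr
  have hx0 : 0 < x := by positivity
  have hx1 : x ≤ 1 := Real.rpow_le_one_of_one_le_of_nonpos (by norm_num) (by linarith)
  have hsqrt1 : (Nat.sqrt m : ℝ) ≤ 2 * s := by
    have := Real.nat_sqrt_le_real_sqrt (a := m)
    rw [hs]
    linarith
  have hsqrt2 : 2 * s < Nat.sqrt m + 1 := by
    have := Real.real_sqrt_lt_nat_sqrt_succ (a := m)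
    rw [hs]
    linarith
  have hr1 : s ≤ r := by
    have h : Nat.sqrt m + 1 ≤ 2 * r := by rw [hr, numClasses]; omega
    have h' : ((Nat.sqrt m : ℝ) + 1) ≤ 2 * r := by exact_mod_cast h
    linarith
  have hr2 : (r : ℝ) ≤ s + 1 := by
    have h : 2 * r ≤ Nat.sqrt m + 2 := by rw [hr, numClasses]; omega
    have h' : 2 * (r : ℝ) ≤ (Nat.sqrt m : ℝ) + 2 := by exact_mod_cast h
    linarith
  have hrpos : (0 : ℝ) < r := by exact_mod_cast numClasses_pos m
  have h1 : ((2 : ℝ) ^ r)⁻¹ ≤ x := by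
    rw [← Real.rpow_natCast, ← Real.rpow_neg (by norm_num)]
    exact Real.rpow_le_rpow_of_exponent_le (by norm_num) (by linarith)
  -- each class has at least `4 s - 5` positions
  have hdiv : 4 * s - 5 ≤ (m / r : ℕ) := by
    have h2 : (m : ℝ) / r < (m / r : ℕ) + 1 := by
      rw [div_lt_iff₀ hrpos]
      have : m < (m / r + 1) * r := by
        rw [Nat.mul_comm]; exact Nat.lt_mul_div_succ m (numClasses_pos m)
      exact_mod_cast this
    have h3 : 4 * (s - 1) ≤ (m : ℝ) / r := by
      rw [le_div_iff₀ hrpos, ← hsm]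
      rcases le_or_gt s 1 with h | h
      · nlinarith
      · nlinarith
    linarith
  have hfree : (freeCount m r : ℝ) / 2 ^ m ≤ 32 * (s + 1) * x ^ 4 := by
    have h2 : (freeCount m r : ℝ) * 2 ^ (m / r) ≤ r * 2 ^ m := by
      exact_mod_cast freeCount_le (numClasses_pos m)
    have h3 : (freeCount m r : ℝ) / 2 ^ m ≤ r * ((2 : ℝ) ^ (m / r))⁻¹ := by
      rw [div_le_iff₀ (by positivity), mul_right_comm, ← div_eq_mul_inv,
        le_div_iff₀ (by positivity)]
      exact h2
    have h4 : ((2 : ℝ) ^ (m / r))⁻¹ ≤ 32 * x ^ 4 := by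
      have h5 : 32 * x ^ 4 = (2 : ℝ) ^ (-(4 * s - 5)) := by
        rw [hx, ← Real.rpow_natCast, ← Real.rpow_mul (by norm_num),
          show (32 : ℝ) = 2 ^ (5 : ℝ) by norm_num, ← Real.rpow_add (by norm_num)]
        congr 1
        push_cast
        ring
      rw [h5, ← Real.rpow_natCast, ← Real.rpow_neg (by norm_num)]
      exact Real.rpow_le_rpow_of_exponent_le (by norm_num) (by linarith)
    calc (freeCount m r : ℝ) / 2 ^ m ≤ r * ((2 : ℝ) ^ (m / r))⁻¹ := h3
      _ ≤ (s + 1) * (32 * x ^ 4) := mul_le_mul hr2 h4 (by positivity) (by linarith)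
      _ = 32 * (s + 1) * x ^ 4 := by ring
  have hsx : (s + 1) * x ≤ 2 := by
    have h2 : s + 1 ≤ 2 * (2 : ℝ) ^ s := by
      have h3 := Real.add_one_le_exp (Real.log 2 * s)
      rw [← Real.rpow_def_of_pos (by norm_num)] at h3
      nlinarith [Real.log_two_gt_d9]
    rw [hx, Real.rpow_neg (by norm_num), ← div_eq_mul_inv, div_le_iff₀ (by positivity)]
    exact h2
  have hlast : (1 + x⁻¹) * ((freeCount m r : ℝ) / 2 ^ m) ≤ 128 * x := by
    calc (1 + x⁻¹) * ((freeCount m r : ℝ) / 2 ^ m)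
        ≤ (1 + x⁻¹) * (32 * (s + 1) * x ^ 4) :=
          mul_le_mul_of_nonneg_left hfree (by positivity)
      _ = 32 * ((s + 1) * x) * ((x + 1) * x * x) := by field_simp
      _ ≤ 32 * 2 * ((1 + 1) * 1 * x) := by gcongr
      _ = 128 * x := by ring
  linarith

theorem negligible_rpow_sqrt {n : ℕ → ℕ}
    (hn : (fun κ : ℕ => Real.log (κ : ℝ) ^ 2) =o[atTop] (fun κ : ℕ => (n κ : ℝ))) :
    Negligible fun κ => (2 : ℝ) ^ (-(1 / 2 : ℝ) * Real.sqrt (n κ : ℝ)) := by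
  intro k
  -- `√n` eventually exceeds every multiple of `log κ`; this one leaves a factor `κ⁻¹` to spare
  set M : ℝ := 2 * (k + 1) / Real.log 2 with hM
  have hlog2 : 0 < Real.log 2 := Real.log_pos (by norm_num)
  have hM0 : 0 < M := by positivity
  have h1 : ∀ᶠ κ : ℕ in atTop, M * Real.log κ ≤ Real.sqrt (n κ) := by
    have h2 := hn.def (c := (M ^ 2)⁻¹) (by positivity)
    filter_upwards [h2] with κ h3
    refine Real.le_sqrt_of_sq_le ?_
    rw [Real.norm_of_nonneg (by positivity), Real.norm_of_nonneg (by positivity)] at h3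
    rw [mul_pow]
    calc M ^ 2 * Real.log κ ^ 2 ≤ M ^ 2 * ((M ^ 2)⁻¹ * (n κ : ℝ)) := by gcongr
      _ = (n κ : ℝ) := by field_simp
  have h2 : Tendsto (fun κ : ℕ => ((κ : ℝ))⁻¹) atTop (nhds 0) :=
    tendsto_inv_atTop_nhds_zero_nat
  refine squeeze_zero' (Eventually.of_forall fun κ => by positivity) ?_ h2
  filter_upwards [h1, eventually_gt_atTop 0] with κ h3 h4
  have hκ : (0 : ℝ) < κ := by exact_mod_cast h4
  have h5 : (2 : ℝ) ^ (-(1 / 2 : ℝ) * Real.sqrt (n κ : ℝ)) ≤ (κ : ℝ) ^ (-((k : ℝ) + 1)) := by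
    rw [Real.rpow_def_of_pos (by norm_num), Real.rpow_def_of_pos hκ]
    refine Real.exp_le_exp.mpr ?_
    have h6 : Real.log 2 * (M * Real.log κ) = 2 * (k + 1) * Real.log κ := by
      rw [hM]; field_simp
    have h7 := mul_le_mul_of_nonneg_left h3 hlog2.le
    linarith
  calc (κ : ℝ) ^ k * (2 : ℝ) ^ (-(1 / 2 : ℝ) * Real.sqrt (n κ : ℝ))
      ≤ (κ : ℝ) ^ k * (κ : ℝ) ^ (-((k : ℝ) + 1)) := by gcongr
    _ = (κ : ℝ)⁻¹ := by
      rw [← Real.rpow_natCast, ← Real.rpow_add hκ, ← Real.rpow_neg_one]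
      congr 1
      ring

end CompMOE

theorem corollary3p3 :
    ∃ ε : ℕ → ℝ, CompMOE.IsSoftO ε (fun m => (2 : ℝ) ^ (-(1 / 2 : ℝ) * Real.sqrt (m : ℝ))) ∧
      ∀ (q n : ℕ → ℕ), CompMOE.PolyBounded q → CompMOE.PolyBounded n →
      (fun κ : ℕ => Real.log (κ : ℝ) ^ 2) =o[Filter.atTop] (fun κ : ℕ => (n κ : ℝ)) →
      ∀ (Z : ∀ κ, PMF (CompMOE.Bits (q κ) × CompMOE.Bits (n κ))) (η : ℕ → ℝ),
      CompMOE.Negligible η →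
      CompMOE.StronglyIndist η (fun κ => CompMOE.pairState (Z κ))
        (fun κ => CompMOE.pairState (CompMOE.refresh (Z κ))) →
      ∀ S : CompMOE.Strategy q n,
        (∃ κ₀ : ℕ, ∀ κ, κ₀ ≤ κ → S.winProb Z κ ≤ ε (n κ) + η κ) ∧
        CompMOE.Negligible (fun κ => S.winProb Z κ) := by
  -- the logarithmic factor is not needed: `ε` is a multiple of the comparison function
  refine ⟨fun m => 130 * (2 : ℝ) ^ (-(1 / 2 : ℝ) * Real.sqrt (m : ℝ)), ⟨0, ?_⟩, ?_⟩
  · simp only [pow_zero, mul_one]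
    exact isBigO_const_mul_self _ _ _
  intro q n _ hnpoly hn Z η hη hind S
  have hpos : ∀ᶠ κ in atTop, 0 < n κ := by
    filter_upwards [hn.def one_pos, eventually_ge_atTop 2] with κ h1 h2
    by_contra h3
    have h4 : n κ = 0 := by omega
    have h5 : 0 < Real.log κ := Real.log_pos (by exact_mod_cast h2)
    rw [h4, Nat.cast_zero, norm_zero, mul_zero, norm_le_zero_iff] at h1
    exact (pow_pos h5 2).ne' h1
  have hwin : ∀ᶠ κ in atTop, S.winProb Z κ ≤
      130 * (2 : ℝ) ^ (-(1 / 2 : ℝ) * Real.sqrt (n κ : ℝ)) + η κ := by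
    obtain ⟨κ₁, hκ₁⟩ := hind (CompMOE.testDistinguisher S hnpoly)
    filter_upwards [hpos, eventually_ge_atTop κ₁] with κ h1 h2
    -- the weight `t = √x` turns the acceptance probability's surplus `t ^ 2` into `x`
    set x : ℝ := (2 : ℝ) ^ (-(1 / 2 : ℝ) * Real.sqrt (n κ : ℝ)) with hx
    have hx0 : 0 < x := by positivity
    have h3 := S.winProb_le hnpoly Z κ h1 (Real.sqrt_pos.mpr hx0) (hκ₁ κ h2)
    rw [Real.sq_sqrt hx0.le] at h3
    have h4 := CompMOE.error_le (n κ)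
    rw [← hx] at h4
    linarith
  refine ⟨eventually_atTop.mp hwin, ?_⟩
  refine SuperpolynomialDecay.trans_eventually_abs_le
    (((CompMOE.negligible_rpow_sqrt hn).const_mul 130).add hη) ?_
  filter_upwards [hwin] with κ h
  exact (abs_of_nonneg (S.winProb_nonneg κ Z)).le.trans (h.trans (le_abs_self _))
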